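/- Let $K\ge 1$ be an integer, $\vec a=[a_1,\dots,a_p]$ ($p\ge 0$) a list of complex numbers, and $\sigma\in\mathbb C$ with $2\sigma\notin\mathbb Z$ and $a_i\pm\sigma\notin\{-1,-2,-3,\dots\}$ for all $i$. Put $P(\vec a;z)=\prod_i(z+a_i)$, $\Gamma(\vec a;z)=\prod_i\Gamma(z+a_i)$, $G(\vec a;z)=\prod_i G(z+a_i)$, where $\Gamma$ is the gamma function and $G$ is Barnes' $G$-function (empty products are $1$). For partitions $\lambda,\mu$ with transposes $\lambda',\mu'$ and hook lengths $h_\lambda(i,j)=\lambda_i-i+\lambda'_j-j+1$ let $$\mathcal B_{\lambda,\mu}(\vec a;\sigma)=\prod_{(i,j)\in\lambda}\frac{P(\vec a;i-j+\sigma)}{h_\lambda(i,j)^2(\lambda'_j+\mu_i-i-j+1+2\sigma)^2}\prod_{(i,j)\in\mu}\frac{P(\vec a;i-j-\sigma)}{h_\mu(i,j)^2(\lambda_i+\mu'_j-i-j+1-2\sigma)^2},$$ and let $|\lambda|$ and $\ell(\lambda)$ denote the weight and the length (number of nonzero parts). Let $$w(z)=\frac{1}{\Gamma(\vec a;K-z)\,\Gamma(z+1+\sigma)^2\,\Gamma(z+1-\sigma)^2},\qquad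 Q(\vec a,K,\sigma)=\frac{G(\vec a;K+1+\sigma)G(\vec a;K+1-\sigma)}{G(\vec a;1+\sigma)G(\vec a;1-\sigma)}\,\Gamma(2\sigma)^{2K}\,\Gamma(1-2\sigma)^{2K},$$ where $w$ is an entire function ($1/\Gamma$ vanishes at the poles of $\Gamma$). For $q\neq 0$ let $\nu=\nu_q$ be the discrete complex measure $$\nu=q\sum_{k\ge0}w(k+\sigma)\,\delta_{k+\sigma}+q^{-1}\sum_{k\ge0}w(k-\sigma)\,\delta_{k-\sigma},$$ and $\psi(u)=\psi_q(u)=\int e^{uz}\,d\nu(z)$ its moment generating function, whose domain is the set of all $u\in\mathbb C$ for which both sums defining the integral converge absolutely. Derivatives of $\psi$ are complex derivatives taken within this domain (ordinary ones at interior points, from inside at boundary points). Let $u\in\mathbb C$ be such that the derivatives $\psi^{(k)}(u)$, $0\le k\le 4K-2$, exist in the sense that the differentiated integrals $\int z^k e^{uz}\,d\nu(z)$ converge absolutely (which is automatic at interior points of the domain). Then for every $q$ with $|q|=1$ the function $\psi_q$ is $4K-2$ times continuously differentiable at $u$ within its domain, the function $q\mapsto q^{-1}\det(\psi_q^{(i+j-2)}(u))_{i,j=1}^{2K}$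 is integrable on the circle $|q|=1$, the sum below over all pairs of partitions of length at most $K$ converges absolutely, and, with $t=e^u$, $$\sum_{\ell(\lambda)\le K,\ \ell(\mu)\le K}\mathcal B_{\lambda,\mu}(\vec a;\sigma)\,e^{u(|\lambda|+|\mu|)}=\frac{Q(\vec a,K,\sigma)}{t^{K(K-1)}}\,\frac1{2\pi i}\oint_{|q|=1}\det\left(\psi_q^{(i+j-2)}(u)\right)_{i,j=1}^{2K}\frac{dq}{q}.$$ -/

import Mathlib

open scoped Real

noncomputable section

namespace PainleveBlock

/-- `P(a; z) = ∏ᵢ (z + aᵢ)`. -/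
def P {p : ℕ} (a : Fin p → ℂ) (z : ℂ) : ℂ := ∏ i, (z + a i)

/-- `Γ(a; z) = ∏ᵢ Γ(z + aᵢ)`. -/
def GammaList {p : ℕ} (a : Fin p → ℂ) (z : ℂ) : ℂ := ∏ i, Complex.Gamma (z + a i)

/-- The Barnes `G`-function through its Weierstrass product: with `s = z - 1`,
`G(s + 1) = (2π)^(s/2) exp(-s(s+1)/2 - γ s²/2) ∏_{k ≥ 1} (1 + s/k)^k exp(-s + s²/(2k))`. -/
def barnesG (z : ℂ) : ℂ :=
  (2 * (π : ℂ)) ^ ((z - 1) / 2) *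
    Complex.exp (-((z - 1) * z) / 2 - (Real.eulerMascheroniConstant : ℂ) * (z - 1) ^ 2 / 2) *
    ∏' k : ℕ, ((1 + (z - 1) / ((k : ℂ) + 1)) ^ (k + 1) *
      Complex.exp (-(z - 1) + (z - 1) ^ 2 / (2 * ((k : ℂ) + 1))))

/-- `G(a; z) = ∏ᵢ G(z + aᵢ)`. -/
def GList {p : ℕ} (a : Fin p → ℂ) (z : ℂ) : ℂ := ∏ i, barnesG (z + a i)

/-- The hook length `λᵢ - i + λ'ⱼ - j + 1`. Cells of a `YoungDiagram` are pairs `c = (i - 1, j - 1)`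
counted from zero, `rowLen` gives the parts of `λ` and `colLen` those of the transpose `λ'`. -/
def hook (lam : YoungDiagram) (c : ℕ × ℕ) : ℂ :=
  (lam.rowLen c.1 : ℂ) - (c.1 + 1) + (lam.colLen c.2 : ℂ) - (c.2 + 1) + 1

/-- The mixed hook length `λ'ⱼ + μᵢ - i - j + 1` of the cell `c = (i - 1, j - 1)`. -/
def mixedHook (lam mu : YoungDiagram) (c : ℕ × ℕ) : ℂ :=
  (lam.colLen c.2 : ℂ) + (mu.rowLen c.1 : ℂ) - (c.1 + 1) - (c.2 + 1) + 1

/-- The coefficient `B_{λ,μ}(a; σ)`. -/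
def blockCoeff {p : ℕ} (a : Fin p → ℂ) (σ : ℂ) (lam mu : YoungDiagram) : ℂ :=
  (∏ c ∈ lam.cells, P a ((c.1 : ℂ) - c.2 + σ) /
      (hook lam c ^ 2 * (mixedHook lam mu c + 2 * σ) ^ 2)) *
  (∏ c ∈ mu.cells, P a ((c.1 : ℂ) - c.2 - σ) /
      (hook mu c ^ 2 * (mixedHook mu lam c - 2 * σ) ^ 2))

/-- The length of a partition, i.e. the number of its nonzero parts. -/
def length (lam : YoungDiagram) : ℕ := lam.colLen 0

/-- Pairs of partitions, both of length at most `K`. -/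
def RestrictedPairs (K : ℕ) : Type :=
  {x : YoungDiagram × YoungDiagram // length x.1 ≤ K ∧ length x.2 ≤ K}

/-- The weight `w(z) = 1 / (Γ(a; K - z) Γ(z + 1 + σ)² Γ(z + 1 - σ)²)`. It is an entire function of
`z`: as `Complex.Gamma` is set to `0` at the poles, `0⁻¹ = 0` is the correct value of `1 / Γ` there. -/
def weight {p : ℕ} (a : Fin p → ℂ) (K : ℕ) (σ z : ℂ) : ℂ :=
  1 / (GammaList a (K - z) * Complex.Gamma (z + 1 + σ) ^ 2 * Complex.Gamma (z + 1 - σ) ^ 2)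

/-- The prefactor `Q(a, K, σ)`. -/
def Q {p : ℕ} (a : Fin p → ℂ) (K : ℕ) (σ : ℂ) : ℂ :=
  (GList a (K + 1 + σ) * GList a (K + 1 - σ)) / (GList a (1 + σ) * GList a (1 - σ)) *
    Complex.Gamma (2 * σ) ^ (2 * K) * Complex.Gamma (1 - 2 * σ) ^ (2 * K)

/-- Convergence of the integral of `f` against the discrete measure `ν`: the two sums over
`ℕ + σ` and over `ℕ - σ` converge absolutely (the factors `q`, `q⁻¹` play no role). -/
def NuIntegrable {p : ℕ} (a : Fin p → ℂ) (K : ℕ) (σ : ℂ) (f : ℂ → ℂ) : Prop :=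
  Summable (fun k : ℕ => weight a K σ (k + σ) * f (k + σ)) ∧
  Summable (fun k : ℕ => weight a K σ (k - σ) * f (k - σ))

/-- The integral of `f` against
`ν = q ∑ₖ w(k + σ) δ_{k + σ} + q⁻¹ ∑ₖ w(k - σ) δ_{k - σ}`. -/
def nuIntegral {p : ℕ} (a : Fin p → ℂ) (K : ℕ) (σ q : ℂ) (f : ℂ → ℂ) : ℂ :=
  q * ∑' k : ℕ, weight a K σ (k + σ) * f (k + σ) +
    q⁻¹ * ∑' k : ℕ, weight a K σ (k - σ) * f (k - σ)

/-- The moment generating function `ψ(u) = ∫ e^{uz} dν(z)`. -/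
def mgf {p : ℕ} (a : Fin p → ℂ) (K : ℕ) (σ q u : ℂ) : ℂ :=
  nuIntegral a K σ q (fun z => Complex.exp (u * z))

/-- The domain of `ψ`: the set of `u` for which the integral defining `ψ(u)` converges. -/
def mgfDomain {p : ℕ} (a : Fin p → ℂ) (K : ℕ) (σ : ℂ) : Set ℂ :=
  {u | NuIntegrable a K σ (fun z => Complex.exp (u * z))}

/-- The derivative `ψ⁽ⁿ⁾(u)`, taken within the domain of `ψ`: the ordinary complex derivative at
interior points of the domain, and the derivative from inside the domain at its boundary points. -/
def mgfDeriv {p : ℕ} (a : Fin p → ℂ) (K : ℕ) (σ q : ℂ) (n : ℕ) (u : ℂ) : ℂ :=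
  iteratedDerivWithin n (mgf a K σ q) (mgfDomain a K σ) u

/-- The determinant `det (ψ^{(i+j-2)}(u))`, `1 ≤ i, j ≤ 2K` (the indices here start from zero). -/
def wronskian {p : ℕ} (a : Fin p → ℂ) (K : ℕ) (σ q u : ℂ) : ℂ :=
  Matrix.det (Matrix.of fun i j : Fin (2 * K) => mgfDeriv a K σ q ((i : ℕ) + (j : ℕ)) u)

end PainleveBlock

end

/-! The identity is a Heine-type expansion of a Hankel determinant. Each entry of the determinant is
a moment of the discrete measure `ν`. Expanding by multilinearity gives an absolutely convergent sum
over `2K`-tuples of support points in `(ℕ + σ) ⊔ (ℕ - σ)`, and summing over the orderings of a given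
set of points produces a squared Vandermonde product times the weights. The power of `q` counts
points of `ℕ + σ` minus points of `ℕ - σ`, so integration over the circle keeps exactly the sets
with `K` points of each kind. Such a set is a pair of partitions of length at most `K`: the points
are `μᵢ + K - i + σ` and `λᵢ + K - i - σ`.

It remains to identify the term of each pair (`blockCoeff_eq`). Ordinary and mixed hook products
become factorials and Gamma values divided by differences of points (`prod_hook`,
`prod_mixedHook_sq`), because along a row the column lengths enumerate the gaps between the points
(`range_bead_eq_union`). The content products become values of `1 / Γ(a; K - z)` (`prod_P`). The
leftover constants form `Q`; Barnes' function enters only through `G(z + K) / G(z)`, a product of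
`K` Gamma values (`barnesG_add_one`). The exponentials contribute `t ^ (|λ| + |μ| + K(K-1))`.

On the analytic side, the domain of `ψ` is locally a closed half-plane, where dominated convergence
permits termwise differentiation up to the boundary (`mgfDeriv_eq`). -/

namespace PainleveBlock
open Filter Topology

/-! ### Convergence, zeros and functional equation of Barnes' `G`-function -/

/-- The factor with index `k + 1` in the Weierstrass product of `G(s + 1)`. -/
noncomputable def barnesFactor (s : ℂ) (k : ℕ) : ℂ :=
  (1 + s / ((k : ℂ) + 1)) ^ (k + 1) * Complex.exp (-s + s ^ 2 / (2 * ((k : ℂ) + 1)))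

lemma barnesG_eq (z : ℂ) : barnesG z = (2 * (π : ℂ)) ^ ((z - 1) / 2) *
    Complex.exp (-((z - 1) * z) / 2 - (Real.eulerMascheroniConstant : ℂ) * (z - 1) ^ 2 / 2) *
    ∏' k : ℕ, barnesFactor (z - 1) k := rfl

/-- With `x = s / (k + 1)` the factor is the exponential of `(k + 1) (log (1 + x) - x + x² / 2)`,
and the Taylor remainder of the logarithm is cubic in `x`. -/
lemma norm_barnesFactor_sub_one_le (s : ℂ) (k : ℕ) (h1 : 2 * ‖s‖ ≤ k + 1)
    (h2 : ‖s‖ ^ 3 ≤ ((k : ℝ) + 1) ^ 2) :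
    ‖barnesFactor s k - 1‖ ≤ 2 * ‖s‖ ^ 3 * (1 / ((k : ℝ) + 1) ^ 2) := by
  have hk : (0 : ℝ) < k + 1 := by positivity
  have hkc : (k : ℂ) + 1 ≠ 0 := by exact_mod_cast hk.ne'
  have hkn : ‖(k : ℂ) + 1‖ = k + 1 := by
    have : (k : ℂ) + 1 = ((k + 1 : ℝ) : ℂ) := by push_cast; rfl
    rw [this, Complex.norm_of_nonneg hk.le]
  set x : ℂ := s / ((k : ℂ) + 1) with hx
  have hxn : ‖x‖ = ‖s‖ / (k + 1) := by rw [hx, norm_div, hkn]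
  have hxh : ‖x‖ ≤ 1 / 2 := by
    rw [hxn, div_le_iff₀ hk]; linarith
  have hx1 : 1 + x ≠ 0 := by
    intro h
    have : x = -1 := by linear_combination h
    rw [this] at hxh; norm_num at hxh
  set y : ℂ := ((k : ℂ) + 1) * (Complex.log (1 + x) - Complex.logTaylor 3 x) with hy
  have hT : Complex.logTaylor 3 x = x - x ^ 2 / 2 := by
    simp [Complex.logTaylor, Finset.sum_range_succ]
    ring
  have hb : barnesFactor s k = Complex.exp y := by
    have : y = ((k + 1 : ℕ) : ℂ) * Complex.log (1 + x) + (-s + s ^ 2 / (2 * ((k : ℂ) + 1))) := by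
      rw [hy, hT, hx]; push_cast; field_simp; ring
    rw [this, Complex.exp_add, Complex.exp_nat_mul, Complex.exp_log hx1]
    rfl
  have hyn : ‖y‖ ≤ ‖s‖ ^ 3 * (1 / ((k : ℝ) + 1) ^ 2) := by
    have := Complex.norm_log_sub_logTaylor_le 2 (z := x) (by linarith)
    have h3 : (1 - ‖x‖)⁻¹ ≤ 2 := by
      rw [inv_le_comm₀ (by linarith) (by norm_num)]; linarith
    calc ‖y‖ = ((k : ℝ) + 1) * ‖Complex.log (1 + x) - Complex.logTaylor 3 x‖ := by
          rw [hy, norm_mul, hkn]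
      _ ≤ ((k : ℝ) + 1) * (‖x‖ ^ 3 * 2 / (2 + 1)) := by
          gcongr
          refine this.trans ?_
          push_cast
          gcongr
      _ ≤ ((k : ℝ) + 1) * ‖x‖ ^ 3 := by
          have : 0 ≤ ‖x‖ ^ 3 := by positivity
          gcongr; linarith
      _ = _ := by rw [hxn]; field_simp
  have hy1 : ‖y‖ ≤ 1 := by
    refine hyn.trans ?_
    rw [mul_one_div]
    exact div_le_one_of_le₀ h2 (by positivity)
  rw [hb]
  refine (Complex.norm_exp_sub_one_le hy1).trans ?_
  linarith

lemma summable_norm_barnesFactor_sub_one (s : ℂ) :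
    Summable fun k => ‖barnesFactor s k - 1‖ := by
  have hs : Summable fun k : ℕ => 2 * ‖s‖ ^ 3 * (1 / ((k : ℝ) + 1) ^ 2) := by
    refine Summable.mul_left _ ?_
    have := (summable_nat_add_iff 1).2 (Real.summable_one_div_nat_pow.2 (one_lt_two))
    simpa using this
  refine Summable.of_norm_bounded_eventually_nat hs ?_
  have e1 : ∀ᶠ k : ℕ in atTop, 2 * ‖s‖ ≤ (k : ℝ) :=
    tendsto_natCast_atTop_atTop.eventually_ge_atTop _
  have e2 : ∀ᶠ k : ℕ in atTop, ‖s‖ ^ 3 ≤ (k : ℝ) :=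
    tendsto_natCast_atTop_atTop.eventually_ge_atTop _
  filter_upwards [e1, e2] with k h1 h2
  rw [norm_norm]
  refine norm_barnesFactor_sub_one_le s k (by linarith) ?_
  nlinarith [Nat.cast_nonneg (α := ℝ) k]

lemma multipliable_barnesFactor (s : ℂ) : Multipliable (barnesFactor s) := by
  have := multipliable_one_add_of_summable (summable_norm_barnesFactor_sub_one s)
  simpa using this

lemma tprod_barnesFactor_ne_zero (s : ℂ) (hs : ∀ n : ℕ, s ≠ -((n : ℂ) + 1)) :
    ∏' k, barnesFactor s k ≠ 0 := by
  have := tprod_one_add_ne_zero_of_summable (f := fun k => barnesFactor s k - 1) ?_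
    (summable_norm_barnesFactor_sub_one s)
  · simpa using this
  · intro k
    rw [add_sub_cancel]
    refine mul_ne_zero (pow_ne_zero _ ?_) (Complex.exp_ne_zero _)
    have hkc : (k : ℂ) + 1 ≠ 0 := by exact_mod_cast k.succ_ne_zero
    intro h
    apply hs k
    field_simp at h
    linear_combination h

lemma barnesG_ne_zero (z : ℂ) (hz : ∀ n : ℕ, z ≠ -(n : ℂ)) : barnesG z ≠ 0 := by
  rw [barnesG_eq]
  refine mul_ne_zero (mul_ne_zero ?_ (Complex.exp_ne_zero _)) (tprod_barnesFactor_ne_zero _ ?_)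
  · rw [Ne, Complex.cpow_eq_zero_iff]
    simp [Real.pi_ne_zero]
  · intro n h
    exact hz n (by linear_combination h)

/-- The functional equation at the level of partial products: the quotients of corresponding factors
telescope, leaving one factor `1 / (z + k)` at each step. -/
lemma prod_barnesFactor_eq (z : ℂ) (hz : ∀ n : ℕ, z ≠ -(n : ℂ)) (N : ℕ) :
    ∏ k ∈ Finset.range N, barnesFactor z k =
      (∏ k ∈ Finset.range N, barnesFactor (z - 1) k) *
      (((N : ℂ) + z) ^ N / (∏ k ∈ Finset.range N, (z + k)) *
        Complex.exp (-(N : ℂ) + (z - 1 / 2) * (harmonic N : ℂ))) := by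
  have hz' : ∀ n : ℕ, z + n ≠ 0 := fun n h => hz n (by linear_combination h)
  induction N with
  | zero => simp
  | succ N ih =>
    have hN : (N : ℂ) + 1 ≠ 0 := by exact_mod_cast N.succ_ne_zero
    have hzN := hz' N
    have hp : ∏ k ∈ Finset.range N, (z + k) ≠ 0 := Finset.prod_ne_zero_iff.2 fun k _ => hz' k
    have key : barnesFactor z N = barnesFactor (z - 1) N *
        ((((N + 1 : ℕ) : ℂ) + z) ^ (N + 1) / ((N : ℂ) + z) ^ (N + 1) *
          Complex.exp (-1 + (z - 1 / 2) * ((N : ℂ) + 1)⁻¹)) := by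
      have e1 : 1 + z / ((N : ℂ) + 1) = (((N + 1 : ℕ) : ℂ) + z) / (N + 1) := by
        push_cast; field_simp
      have e2 : 1 + (z - 1) / ((N : ℂ) + 1) = ((N : ℂ) + z) / (N + 1) := by
        field_simp; ring
      have e3 : -z + z ^ 2 / (2 * ((N : ℂ) + 1)) = (-(z - 1) + (z - 1) ^ 2 / (2 * ((N : ℂ) + 1))) +
          (-1 + (z - 1 / 2) * ((N : ℂ) + 1)⁻¹) := by
        field_simp; ring
      have : ((N : ℂ) + z) ^ (N + 1) ≠ 0 := pow_ne_zero _ (by rwa [add_comm])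
      rw [barnesFactor, barnesFactor, e1, e2, e3, Complex.exp_add, div_pow, div_pow]
      field_simp
    rw [Finset.prod_range_succ, ih, key, Finset.prod_range_succ, Finset.prod_range_succ,
      harmonic_succ]
    have : -((N + 1 : ℕ) : ℂ) + (z - 1 / 2) * ((harmonic N + ((N + 1 : ℕ) : ℚ)⁻¹ : ℚ) : ℂ) =
      (-(N : ℂ) + (z - 1 / 2) * (harmonic N : ℂ)) + (-1 + (z - 1 / 2) * ((N : ℂ) + 1)⁻¹) := by
      push_cast; ring
    rw [this]
    generalize -(N : ℂ) + (z - 1 / 2) * (harmonic N : ℂ) = A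
    generalize -1 + (z - 1 / 2) * ((N : ℂ) + 1)⁻¹ = B
    rw [Complex.exp_add]
    have h4 : (N : ℂ) + z ≠ 0 := by rwa [add_comm]
    rw [pow_succ ((N : ℂ) + z) N, add_comm z (N : ℂ)]
    field_simp

/-- The expression is regrouped into Gauss' sequence for `Γ(z)`, `(1 + z/N)^N`, the exponential of
`(z - 1/2)(H_N - log N)`, and the reciprocal of Stirling's sequence scaled by `√2`. -/
lemma tendsto_barnes_ratio (z : ℂ) :
    Tendsto (fun N : ℕ => ((N : ℂ) + z) ^ N / (∏ k ∈ Finset.range N, (z + k)) *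
        Complex.exp (-(N : ℂ) + (z - 1 / 2) * (harmonic N : ℂ))) atTop
      (𝓝 (Complex.Gamma z * Complex.exp z *
        Complex.exp ((z - 1 / 2) * (Real.eulerMascheroniConstant : ℂ)) *
        ((√(2 * π) : ℝ) : ℂ)⁻¹)) := by
  have hst : Tendsto (fun N : ℕ => ((√2 * Stirling.stirlingSeq N : ℝ) : ℂ)⁻¹) atTop
      (𝓝 ((√(2 * π) : ℝ) : ℂ)⁻¹) := by
    refine Tendsto.inv₀ ?_ (by simp [Real.pi_ne_zero, Real.pi_pos.le])
    refine (Complex.continuous_ofReal.tendsto _).comp ?_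
    rw [Real.sqrt_mul (by norm_num)]
    exact Stirling.tendsto_stirlingSeq_sqrt_pi.const_mul _
  have hh : Tendsto (fun N : ℕ => Complex.exp ((z - 1 / 2) *
      (((harmonic N : ℝ) - Real.log N : ℝ) : ℂ))) atTop
      (𝓝 (Complex.exp ((z - 1 / 2) * (Real.eulerMascheroniConstant : ℂ)))) := by
    refine (Complex.continuous_exp.tendsto _).comp (Tendsto.const_mul _ ?_)
    exact (Complex.continuous_ofReal.tendsto _).comp Real.tendsto_harmonic_sub_log
  -- Gauss' sequence has the extra denominator `z + N`; this factor, tending to one, compensates for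
  -- it.
  have h1 : Tendsto (fun N : ℕ => 1 + z / (N : ℂ)) atTop (𝓝 1) := by
    simpa using (tendsto_const_div_atTop_nhds_zero_nat z).const_add 1
  have := (((Complex.GammaSeq_tendsto_Gamma z).mul
    (Complex.tendsto_one_add_div_pow_exp z)).mul hh).mul hst |>.mul h1
  rw [mul_one] at this
  refine this.congr' ?_
  have h5 : ∀ᶠ N : ℕ in atTop, ‖z‖ < (N : ℝ) :=
    tendsto_natCast_atTop_atTop.eventually_gt_atTop _
  filter_upwards [eventually_gt_atTop 0, h5] with N hN hzN
  have hNc : (N : ℂ) ≠ 0 := by exact_mod_cast hN.ne'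
  have hNr : (0 : ℝ) < N := by exact_mod_cast hN
  have hzN' : z + N ≠ 0 := by
    intro h
    have : z = -(N : ℂ) := by linear_combination h
    rw [this, norm_neg, Complex.norm_natCast] at hzN
    exact lt_irrefl _ hzN
  have hfac : ((N.factorial : ℕ) : ℂ) ≠ 0 := by exact_mod_cast N.factorial_ne_zero
  have hsq : ((√(N : ℝ) : ℝ) : ℂ) ≠ 0 := by
    exact_mod_cast (Real.sqrt_pos.2 hNr).ne'
  have e1 : ((√2 * Stirling.stirlingSeq N : ℝ) : ℂ)⁻¹ =
      ((√(N : ℝ) : ℝ) : ℂ) * (N : ℂ) ^ N * Complex.exp (-(N : ℂ)) / N.factorial := by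
    have : √2 * Stirling.stirlingSeq N =
        N.factorial / (√(N : ℝ) * (N : ℝ) ^ N * Real.exp (-(N : ℝ))) := by
      rw [Stirling.stirlingSeq, Real.sqrt_mul (by norm_num), div_pow, ← Real.exp_nat_mul,
        Real.exp_neg, mul_one]
      have h2 : √(2 : ℝ) ≠ 0 := by positivity
      have h3 : √(N : ℝ) ≠ 0 := (Real.sqrt_pos.2 hNr).ne'
      field_simp
    rw [this]
    push_cast
    rw [inv_div]
  have e2 : Complex.exp ((z - 1 / 2) * (((harmonic N : ℝ) - Real.log N : ℝ) : ℂ)) =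
      Complex.exp ((z - 1 / 2) * (harmonic N : ℂ)) * (((√(N : ℝ) : ℝ) : ℂ) / (N : ℂ) ^ z) := by
    have hs : ((√(N : ℝ) : ℝ) : ℂ) = Complex.exp (1 / 2 * Complex.log N) := by
      rw [Real.sqrt_eq_rpow, Complex.ofReal_cpow hNr.le, Complex.cpow_def_of_ne_zero (by simpa using hNc)]
      push_cast
      rw [mul_comm]
    rw [hs, Complex.cpow_def_of_ne_zero hNc, ← Complex.exp_sub, ← Complex.exp_add]
    congr 1
    push_cast
    ring
  have e3 : 1 + z / (N : ℂ) = ((N : ℂ) + z) / N := by field_simp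
  have e4 : ((√(N : ℝ) : ℝ) : ℂ) * ((√(N : ℝ) : ℝ) : ℂ) = N := by
    rw [← Complex.ofReal_mul, Real.mul_self_sqrt hNr.le]; simp
  have hcz : (N : ℂ) ^ z ≠ 0 := by
    rw [Ne, Complex.cpow_eq_zero_iff]; simp [hNc]
  rw [e1, e2, e3, Complex.GammaSeq, Finset.prod_range_succ, Complex.exp_add, div_pow]
  -- When `z` is among `0, -1, …, -(N-1)`, both sides are zero by the convention for division by
  -- zero.
  by_cases hp : ∏ k ∈ Finset.range N, (z + (k : ℂ)) = 0
  · simp [hp]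
  have h6 : (N : ℂ) + z ≠ 0 := by rwa [add_comm]
  have hNN : (N : ℂ) ^ N ≠ 0 := pow_ne_zero _ hNc
  rw [add_comm z (N : ℂ)]
  field_simp
  linear_combination e4

/-- The functional equation of the Barnes `G`-function. -/
theorem barnesG_add_one (z : ℂ) (hz : ∀ n : ℕ, z ≠ -(n : ℂ)) :
    barnesG (z + 1) = Complex.Gamma z * barnesG z := by
  have h1 := (multipliable_barnesFactor z).hasProd.tendsto_prod_nat
  have h2 := ((multipliable_barnesFactor (z - 1)).hasProd.tendsto_prod_nat).mul
    (tendsto_barnes_ratio z)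
  have h3 := tendsto_nhds_unique h1 (h2.congr fun N => (prod_barnesFactor_eq z hz N).symm)
  rw [barnesG_eq, barnesG_eq, add_sub_cancel_right, h3]
  have h2pi : (2 * (π : ℂ)) ≠ 0 := by simp [Real.pi_ne_zero]
  have e1 : (2 * (π : ℂ)) ^ (z / 2) = (2 * (π : ℂ)) ^ ((z - 1) / 2) * ((√(2 * π) : ℝ) : ℂ) := by
    rw [Real.sqrt_eq_rpow, Complex.ofReal_cpow (by positivity)]
    push_cast
    rw [← Complex.cpow_add _ _ h2pi]
    congr 1; ring
  have hs : ((√(2 * π) : ℝ) : ℂ) ≠ 0 := by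
    exact_mod_cast (Real.sqrt_pos.2 (by positivity)).ne'
  have e2 : Complex.exp (-((z - 1) * z) / 2 - (Real.eulerMascheroniConstant : ℂ) * (z - 1) ^ 2 / 2)
      = Complex.exp (-(z * (z + 1)) / 2 - (Real.eulerMascheroniConstant : ℂ) * z ^ 2 / 2) *
        Complex.exp z * Complex.exp ((z - 1 / 2) * (Real.eulerMascheroniConstant : ℂ)) := by
    rw [← Complex.exp_add, ← Complex.exp_add]
    congr 1; ring
  rw [e1, e2]
  field_simp

lemma barnesG_add_nat (z : ℂ) (hz : ∀ n : ℕ, z ≠ -(n : ℂ)) (K : ℕ) :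
    barnesG (z + K) = (∏ i ∈ Finset.range K, Complex.Gamma (z + i)) * barnesG z := by
  induction K with
  | zero => simp
  | succ K ih =>
    rw [Finset.prod_range_succ, Nat.cast_succ, ← add_assoc, barnesG_add_one, ih]
    · ring
    · intro n h
      exact hz (n + K) (by push_cast; linear_combination h)

end PainleveBlock

/-! ### Beads of a partition, hook products and Gamma quotients -/

namespace PainleveBlock
open Finset

/-- The strictly decreasing sequence `λᵢ + K - i` (with `i` counted from one) of a partition `λ` of
length at most `K`. -/
def bead (K : ℕ) (lam : YoungDiagram) (i : Fin K) : ℕ := lam.rowLen i + (K - 1 - i)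

lemma bead_strictAnti (K : ℕ) (lam : YoungDiagram) : StrictAnti (bead K lam) := by
  intro i k h
  have h1 : (i : ℕ) < k := h
  have h2 := lam.rowLen_anti i k h1.le
  have := k.2
  unfold bead
  omega

lemma bead_add (K : ℕ) (lam : YoungDiagram) (i : Fin K) :
    (bead K lam i : ℂ) = lam.rowLen i + K - (i + 1) := by
  have : bead K lam i + (i + 1) = lam.rowLen i + K := by
    unfold bead; omega
  rw [eq_sub_iff_add_eq]
  exact_mod_cast this

lemma mem_fst_lt {K : ℕ} {lam : YoungDiagram} (h : length lam ≤ K) {c : ℕ × ℕ} (hc : c ∈ lam) :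
    c.1 < K := by
  have h1 : c.1 < lam.colLen c.2 := YoungDiagram.mem_iff_lt_colLen.1 hc
  exact (h1.trans_le (lam.colLen_anti 0 c.2 (Nat.zero_le _))).trans_le h

lemma cells_eq_map {K : ℕ} {lam : YoungDiagram} (h : length lam ≤ K) :
    lam.cells = ((range K).sigma fun i => range (lam.rowLen i)).map
      (Equiv.sigmaEquivProd ℕ ℕ).toEmbedding := by
  ext ⟨i, j⟩
  simp only [YoungDiagram.mem_cells, mem_map_equiv, mem_sigma, mem_range,
    YoungDiagram.mem_iff_lt_rowLen, Equiv.sigmaEquivProd_symm_apply]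
  refine ⟨fun hj => ⟨mem_fst_lt h (YoungDiagram.mem_iff_lt_rowLen.2 hj), hj⟩, fun hj => hj.2⟩

lemma prod_cells {K : ℕ} {lam : YoungDiagram} (h : length lam ≤ K) (f : ℕ × ℕ → ℂ) :
    ∏ c ∈ lam.cells, f c = ∏ i : Fin K, ∏ j ∈ range (lam.rowLen i), f (i, j) := by
  rw [cells_eq_map h, prod_map, prod_sigma, prod_range]
  rfl

lemma card_eq_sum {K : ℕ} {lam : YoungDiagram} (h : length lam ≤ K) :
    lam.card = ∑ i : Fin K, lam.rowLen i := by
  rw [YoungDiagram.card, cells_eq_map h, card_map, card_sigma, sum_range]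
  simp

lemma two_mul_sum_bead {K : ℕ} {lam : YoungDiagram} (h : length lam ≤ K) :
    2 * ∑ i : Fin K, bead K lam i = 2 * lam.card + K * (K - 1) := by
  have : ∑ i : Fin K, (K - 1 - (i : ℕ)) = ∑ i ∈ range K, i := by
    rw [← sum_range (fun i => K - 1 - i), sum_range_reflect (fun i => i)]
  simp only [bead, sum_add_distrib]
  rw [this, mul_add, mul_comm 2 (∑ i ∈ range K, i), sum_range_id_mul_two, card_eq_sum h]

/-- The numbers `K + j - λ'ⱼ` are the gaps of the bead configuration: the equivalence of `j < λₖ`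
and `k < λ'ⱼ` prevents a gap from being a bead. The gaps of the columns meeting row `i` and the
later beads all lie below bead `i`, and there are `λᵢ + (K - 1 - i)` of them, which is the value of
that bead. The subtraction is exact because `λ'ⱼ ≤ K`. -/
lemma range_bead_eq_union {K : ℕ} {lam : YoungDiagram} (h : length lam ≤ K) (i : Fin K) :
    Disjoint ((range (lam.rowLen i)).image fun j => K + j - lam.colLen j)
        ((Ioi i).image (bead K lam)) ∧
      Set.InjOn (fun j => K + j - lam.colLen j) (range (lam.rowLen i)) ∧
      range (bead K lam i) = ((range (lam.rowLen i)).image fun j => K + j - lam.colLen j) ∪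
        ((Ioi i).image (bead K lam)) := by
  have hcol : ∀ j, lam.colLen j ≤ K := fun j => (lam.colLen_anti 0 j (Nat.zero_le _)).trans h
  have hdisj : Disjoint ((range (lam.rowLen i)).image fun j => K + j - lam.colLen j)
      ((Ioi i).image (bead K lam)) := by
    rw [disjoint_left]
    rintro x hx hx'
    simp only [mem_image, mem_range, mem_Ioi] at hx hx'
    obtain ⟨j, hj, rfl⟩ := hx
    obtain ⟨k, hk, hkj⟩ := hx'
    have hc := hcol j
    have hk2 := k.2
    have hiff : j < lam.rowLen k ↔ (k : ℕ) < lam.colLen j := by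
      rw [← YoungDiagram.mem_iff_lt_rowLen, YoungDiagram.mem_iff_lt_colLen]
    unfold bead at hkj
    by_cases hjk : j < lam.rowLen k
    · have := hiff.1 hjk
      omega
    · have := mt hiff.2 hjk
      omega
  have hinj : Set.InjOn (fun j => K + j - lam.colLen j) (range (lam.rowLen i)) := by
    have : StrictMono (fun j => K + j - lam.colLen j) := by
      intro j j' hj
      have h1 := lam.colLen_anti j j' hj.le
      have h2 := hcol j
      dsimp only
      omega
    exact this.injective.injOn
  refine ⟨hdisj, hinj, (eq_of_subset_of_card_le ?_ ?_).symm⟩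
  · intro x hx
    rw [mem_union, mem_image, mem_image] at hx
    rw [mem_range]
    rcases hx with ⟨j, hj, rfl⟩ | ⟨k, hk, rfl⟩
    · have h1 : (i : ℕ) < lam.colLen j := by
        rw [← YoungDiagram.mem_iff_lt_colLen, YoungDiagram.mem_iff_lt_rowLen]
        exact mem_range.1 hj
      have h2 := mem_range.1 hj
      have h3 := hcol j
      unfold bead
      omega
    · exact bead_strictAnti K lam (mem_Ioi.1 hk)
  · rw [card_union_of_disjoint hdisj, card_image_of_injOn hinj,
      card_image_of_injective _ (bead_strictAnti K lam).injective, card_range, card_range,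
      Fin.card_Ioi]
    exact le_rfl

/-- The values `K + j - λ'ⱼ` for the columns `j` meeting row `i`, together with the entries of
`bead K λ` after the `i`-th, exhaust the integers below `bead K λ i`. -/
lemma prod_row {K : ℕ} {lam : YoungDiagram} (h : length lam ≤ K) (i : Fin K) (x : ℂ) :
    (∏ j ∈ range (lam.rowLen i), (x - (K + j - lam.colLen j))) *
      ∏ k ∈ Ioi i, (x - bead K lam k) = ∏ v ∈ range (bead K lam i), (x - v) := by
  obtain ⟨hdisj, hinj, heq⟩ := range_bead_eq_union h i
  have hcol : ∀ j, lam.colLen j ≤ K + j :=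
    fun j => ((lam.colLen_anti 0 j (Nat.zero_le _)).trans h).trans (Nat.le_add_right _ _)
  rw [heq, prod_union hdisj, prod_image hinj,
    prod_image (bead_strictAnti K lam).injective.injOn]
  congr 1
  refine prod_congr rfl fun j _ => ?_
  rw [Nat.cast_sub (hcol j)]
  push_cast
  ring

/-- In row `i`, a shifted mixed hook is `x` minus a gap of `λ`, for `x` equal to bead `i` of `μ`
plus `s`; `prod_row` then applies to each row. -/
lemma prod_mixedHook {K : ℕ} {lam : YoungDiagram} (h : length lam ≤ K) (mu : YoungDiagram) (s : ℂ) :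
    (∏ c ∈ lam.cells, (mixedHook lam mu c + s)) *
      ∏ i, ∏ k ∈ Ioi i, ((bead K mu i : ℂ) + s - bead K lam k) =
    ∏ i : Fin K, ∏ v ∈ range (bead K lam i), ((bead K mu i : ℂ) + s - v) := by
  rw [prod_cells h, ← prod_mul_distrib]
  refine prod_congr rfl fun i _ => ?_
  rw [← prod_row h i]
  congr 1
  refine prod_congr rfl fun j _ => ?_
  rw [bead_add, mixedHook]
  ring

lemma hook_eq_mixedHook (lam : YoungDiagram) (c : ℕ × ℕ) : hook lam c = mixedHook lam lam c := by
  rw [hook, mixedHook]; ring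

/-- The case `μ = λ`, `s = 0` of `prod_mixedHook`, where the product over a row collapses to a
factorial. -/
lemma prod_hook {K : ℕ} {lam : YoungDiagram} (h : length lam ≤ K) :
    (∏ c ∈ lam.cells, hook lam c) *
      ∏ i, ∏ k ∈ Ioi i, ((bead K lam i : ℂ) - bead K lam k) =
    ∏ i, ((bead K lam i).factorial : ℂ) := by
  have := prod_mixedHook h lam 0
  simp only [add_zero, ← hook_eq_mixedHook] at this
  rw [this]
  refine prod_congr rfl fun i _ => ?_
  generalize bead K lam i = n
  rw [← descPochhammer_eval_eq_prod_range, descPochhammer_eval_eq_descFactorial,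
    Nat.descFactorial_self]

/-- Stated for `1 / Γ`, which is entire, so that no pole has to be excluded. -/
lemma inv_Gamma_sub_nat (z : ℂ) (n : ℕ) :
    (Complex.Gamma (z + 1 - n))⁻¹ = (∏ v ∈ range n, (z - v)) * (Complex.Gamma (z + 1))⁻¹ := by
  induction n with
  | zero => simp
  | succ n ih =>
    rw [Complex.one_div_Gamma_eq_self_mul_one_div_Gamma_add_one, prod_range_succ]
    have : z + 1 - ((n + 1 : ℕ) : ℂ) + 1 = z + 1 - n := by push_cast; ring
    rw [this, ih]
    push_cast
    ring

lemma prod_sub_eq_Gamma_div (z : ℂ) (n : ℕ) (hz : ∀ k : ℕ, z + 1 ≠ -(k : ℂ)) :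
    ∏ v ∈ range n, (z - v) = Complex.Gamma (z + 1) * (Complex.Gamma (z + 1 - n))⁻¹ := by
  rw [inv_Gamma_sub_nat, mul_comm (∏ v ∈ range n, (z - (v : ℂ))), mul_inv_cancel_left₀]
  exact Complex.Gamma_ne_zero hz

/-- By reflection, `Γ(1 + x) Γ(1 - x) = π x / sin (π x)`; an integer shift changes the sine only by
a sign, which the square removes. -/
lemma Gamma_reflection_int_shift_sq (s : ℂ) (hs : ∀ n : ℤ, s ≠ n) (n : ℤ) :
    (Complex.Gamma (1 + (s + n)) * Complex.Gamma (1 - (s + n))) ^ 2 =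
      (s + n) ^ 2 * (Complex.Gamma s * Complex.Gamma (1 - s)) ^ 2 := by
  have h0 : s + n ≠ 0 := fun h => hs (-n) (by push_cast; linear_combination h)
  rw [add_comm (1 : ℂ), Complex.Gamma_add_one _ h0, mul_assoc, Complex.Gamma_mul_Gamma_one_sub,
    Complex.Gamma_mul_Gamma_one_sub, mul_pow, div_pow, div_pow]
  congr 2
  have h1 := Complex.sin_sq_add_cos_sq (n * π)
  rw [Complex.sin_int_mul_pi] at h1
  rw [mul_add, mul_comm (π : ℂ) n, Complex.sin_add, Complex.sin_int_mul_pi]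
  linear_combination Complex.sin (π * s) ^ 2 * h1

lemma prod_prod_Ioi_comm {K : ℕ} (f : Fin K → Fin K → ℂ) :
    ∏ i, ∏ k ∈ Ioi i, f i k = ∏ k, ∏ i ∈ Iio k, f i k :=
  prod_comm' (by simp)

lemma prod_prod_eq_Ioi {K : ℕ} (f : Fin K → Fin K → ℂ) :
    ∏ i, ∏ k, f i k = (∏ i, ∏ k ∈ Ioi i, f i k) * (∏ i, f i i) * ∏ i, ∏ k ∈ Ioi i, f k i := by
  rw [prod_prod_Ioi_comm (fun i k => f k i), ← prod_mul_distrib, ← prod_mul_distrib]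
  refine prod_congr rfl fun i _ => ?_
  have h1 : (univ : Finset (Fin K)) = (Ioi i ∪ {i}) ∪ Iio i := by
    ext k; simp only [mem_univ, mem_union, mem_Ioi, mem_Iio, mem_singleton, true_iff]
    rcases lt_trichotomy i k with h | h | h <;> simp [h]
  rw [h1, prod_union, prod_union, prod_singleton]
  · simp
  · rw [disjoint_left]; intro k hk
    simp only [mem_union, mem_Ioi, mem_singleton, mem_Iio] at hk ⊢
    rcases hk with hk | rfl
    · exact hk.not_gt
    · exact lt_irrefl _

/-- In the full product over `(i, k)`, the pairs with `i < k` come from `prod_mixedHook` for `λ`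
and, up to sign, those with `i > k` from the same lemma for `μ`. The two Gamma quotients leave `Γ(1
+ x) Γ(1 - x)` in the denominator, with `x` being `s` plus the difference of the `i`-th beads;
reflection turns it into the diagonal factor. Squaring absorbs all signs. -/
lemma prod_mixedHook_sq {K : ℕ} {lam mu : YoungDiagram} (hl : length lam ≤ K)
    (hm : length mu ≤ K) (s : ℂ) (hs : ∀ n : ℤ, s ≠ n) :
    ((∏ c ∈ lam.cells, (mixedHook lam mu c + s)) * ∏ c ∈ mu.cells, (mixedHook mu lam c - s)) ^ 2 *
      (∏ i, ∏ k, ((bead K mu i : ℂ) + s - bead K lam k)) ^ 2 *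
      (Complex.Gamma s * Complex.Gamma (1 - s)) ^ (2 * K) =
    (∏ i, (Complex.Gamma (bead K mu i + 1 + s) * Complex.Gamma (bead K lam i + 1 - s))) ^ 2 := by
  have h1 := prod_mixedHook hl mu s
  have h2 := prod_mixedHook hm lam (-s)
  simp only [← sub_eq_add_neg] at h2
  have hnz : ∀ (n : ℤ), s + n ≠ 0 := fun n h => hs (-n) (by push_cast; linear_combination h)
  have hg1 : ∀ i, ∏ v ∈ range (bead K lam i), ((bead K mu i : ℂ) + s - v) =
      Complex.Gamma (bead K mu i + 1 + s) *
        (Complex.Gamma (1 + (s + ((bead K mu i : ℤ) - bead K lam i : ℤ))))⁻¹ := by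
    intro i
    rw [prod_sub_eq_Gamma_div]
    · push_cast
      congr 1
      · congr 1; ring
      · congr 2; ring
    · intro k h
      exact hnz (bead K mu i + 1 + k) (by push_cast; linear_combination h)
  have hg2 : ∀ i, ∏ v ∈ range (bead K mu i), ((bead K lam i : ℂ) - s - v) =
      Complex.Gamma (bead K lam i + 1 - s) *
        (Complex.Gamma (1 - (s + ((bead K mu i : ℤ) - bead K lam i : ℤ))))⁻¹ := by
    intro i
    rw [prod_sub_eq_Gamma_div]
    · push_cast
      congr 1
      · congr 1; ring
      · congr 2; ring
    · intro k h
      exact hnz (-(bead K lam i + 1 + k)) (by push_cast; linear_combination -h)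
  simp only [hg1] at h1
  simp only [hg2] at h2
  have h3 : (∏ i, ∏ k ∈ Ioi i, ((bead K mu k : ℂ) + s - bead K lam i)) ^ 2 =
      (∏ i, ∏ k ∈ Ioi i, ((bead K lam i : ℂ) - s - bead K mu k)) ^ 2 := by
    simp only [← prod_pow]
    refine prod_congr rfl fun i _ => prod_congr rfl fun k _ => ?_
    ring
  have h4 : (∏ i : Fin K, ((bead K mu i : ℂ) + s - bead K lam i)) ^ 2 *
      (Complex.Gamma s * Complex.Gamma (1 - s)) ^ (2 * K) =
      (∏ i : Fin K, (Complex.Gamma (1 + (s + ((bead K mu i : ℤ) - bead K lam i : ℤ))) *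
        Complex.Gamma (1 - (s + ((bead K mu i : ℤ) - bead K lam i : ℤ))))) ^ 2 := by
    have : (Complex.Gamma s * Complex.Gamma (1 - s)) ^ (2 * K) =
      ∏ i : Fin K, (Complex.Gamma s * Complex.Gamma (1 - s)) ^ 2 := by
      rw [prod_const, card_univ, Fintype.card_fin, pow_mul]
    rw [this, ← prod_pow, ← prod_pow, ← prod_mul_distrib]
    refine prod_congr rfl fun i _ => ?_
    rw [Gamma_reflection_int_shift_sq s hs]
    push_cast
    ring
  have h5 : (∏ i : Fin K, (Complex.Gamma (1 + (s + ((bead K mu i : ℤ) - bead K lam i : ℤ))) *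
        Complex.Gamma (1 - (s + ((bead K mu i : ℤ) - bead K lam i : ℤ))))) ≠ 0 := by
    refine prod_ne_zero_iff.2 fun i _ => mul_ne_zero ?_ ?_
    · refine Complex.Gamma_ne_zero fun k h => ?_
      exact hnz (1 + (bead K mu i - bead K lam i) + k) (by push_cast at h ⊢; linear_combination h)
    · refine Complex.Gamma_ne_zero fun k h => ?_
      exact hnz (-(1 + k) + (bead K mu i - bead K lam i))
        (by push_cast at h ⊢; linear_combination -h)
  have h6 := congrArg₂ (fun x y => (x * y) ^ 2) h1 h2
  rw [← prod_mul_distrib] at h6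
  rw [prod_prod_eq_Ioi, mul_pow _ (∏ i, ∏ k ∈ Ioi i, ((bead K mu k : ℂ) + s - bead K lam i)), h3,
    mul_pow _ (∏ i : Fin K, ((bead K mu i : ℂ) + s - bead K lam i))]
  calc _ = _ := by ring
    _ = _ := congrArg₂ (· * ·) h6 h4
    _ = _ := by
      rw [← mul_pow, ← prod_mul_distrib]
      congr 1
      refine prod_congr rfl fun i _ => ?_
      rw [prod_ne_zero_iff] at h5
      have := h5 i (mem_univ _)
      obtain ⟨h7, h8⟩ := mul_ne_zero_iff.1 this
      field_simp

end PainleveBlock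

/-! ### The block coefficient in terms of beads -/

namespace PainleveBlock
open Finset

lemma GList_div {p : ℕ} (a : Fin p → ℂ) (K : ℕ) (s : ℂ)
    (ha : ∀ (i : Fin p) (n : ℕ), a i + s ≠ -((n : ℂ) + 1)) :
    GList a (K + 1 + s) / GList a (1 + s) =
      ∏ i : Fin K, ∏ r, Complex.Gamma (i + s + a r + 1) := by
  rw [GList, GList, ← prod_div_distrib, prod_comm]
  refine prod_congr rfl fun r _ => ?_
  have h : ∀ n : ℕ, 1 + s + a r ≠ -(n : ℂ) := fun n h => ha r n (by linear_combination h)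
  have e : (K : ℂ) + 1 + s + a r = 1 + s + a r + K := by ring
  rw [e, barnesG_add_nat _ h, mul_div_assoc, div_self (barnesG_ne_zero _ h), mul_one, prod_range]
  refine prod_congr rfl fun i _ => ?_
  congr 1; ring

/-- The contents decrease by one along a row, so each row and each `aᵣ` give a quotient of Gamma
values. The numerators do not involve `λ` and assemble into the quotient of `G`-values; the
denominators are values of `Γ(a; K - z)` at the beads shifted by `-s`. -/
lemma prod_P {p : ℕ} (a : Fin p → ℂ) {K : ℕ} {lam : YoungDiagram} (h : length lam ≤ K) (s : ℂ)
    (ha : ∀ (i : Fin p) (n : ℕ), a i + s ≠ -((n : ℂ) + 1)) :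
    ∏ c ∈ lam.cells, P a ((c.1 : ℂ) - c.2 + s) =
      GList a (K + 1 + s) / GList a (1 + s) *
        ∏ i, (GammaList a (K - (bead K lam i - s)))⁻¹ := by
  rw [prod_cells h, GList_div a K s ha, ← prod_mul_distrib]
  refine prod_congr rfl fun i _ => ?_
  simp only [P, GammaList]
  rw [prod_comm, ← prod_inv_distrib, ← prod_mul_distrib]
  refine prod_congr rfl fun r _ => ?_
  have e : (K : ℂ) - (bead K lam i - s) + a r = i + s + a r + 1 - lam.rowLen i := by
    rw [bead_add]; ring
  rw [e, ← prod_sub_eq_Gamma_div]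
  · refine prod_congr rfl fun j _ => ?_
    ring
  · intro k hk
    exact ha r (i + k) (by push_cast; linear_combination hk)

lemma prod_hook_ne_zero {K : ℕ} {lam : YoungDiagram} (h : length lam ≤ K) :
    (∏ c ∈ lam.cells, hook lam c) ≠ 0 := by
  refine left_ne_zero_of_mul (b := ∏ i, ∏ k ∈ Ioi i, ((bead K lam i : ℂ) - bead K lam k)) ?_
  rw [prod_hook h]
  exact prod_ne_zero_iff.2 fun i _ => by exact_mod_cast Nat.factorial_ne_zero _

/-- The coefficient `B_{λ,μ}(a; σ)` as a squared Vandermonde product of the points `λᵢ + K - i - σ`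
and `μᵢ + K - i + σ` times the product of their weights. -/
theorem blockCoeff_eq {p : ℕ} (a : Fin p → ℂ) {K : ℕ} {lam mu : YoungDiagram}
    (hl : length lam ≤ K) (hm : length mu ≤ K) (σ : ℂ) (hσ : ∀ n : ℤ, 2 * σ ≠ n)
    (ha : ∀ (i : Fin p) (n : ℕ), a i + σ ≠ -((n : ℂ) + 1) ∧ a i - σ ≠ -((n : ℂ) + 1)) :
    blockCoeff a σ lam mu = Q a K σ *
      ((∏ i, ∏ k ∈ Ioi i, ((bead K lam i : ℂ) - bead K lam k)) *
        (∏ i, ∏ k ∈ Ioi i, ((bead K mu i : ℂ) - bead K mu k)) *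
        ∏ i, ∏ k, ((bead K mu i : ℂ) + 2 * σ - bead K lam k)) ^ 2 *
      ((∏ i, weight a K σ (bead K lam i - σ)) * ∏ i, weight a K σ (bead K mu i + σ)) := by
  have hnz : ∀ (n : ℤ), 2 * σ + n ≠ 0 := fun n h => hσ (-n) (by push_cast; linear_combination h)
  have ha2 : ∀ (i : Fin p) (n : ℕ), a i + -σ ≠ -((n : ℂ) + 1) :=
    fun i n => by rw [← sub_eq_add_neg]; exact (ha i n).2
  have hP1 := prod_P a hl σ fun i n => (ha i n).1
  have hP2 := prod_P a hm (-σ) ha2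
  simp only [← sub_eq_add_neg, sub_neg_eq_add] at hP2
  have hX := prod_mixedHook_sq hl hm (2 * σ) hσ
  have hH1 := prod_hook hl
  have hH2 := prod_hook hm
  have hH1' := prod_hook_ne_zero hl
  have hH2' := prod_hook_ne_zero hm
  -- At a support point one of the two Gamma arguments in the weight is an integer and gives a
  -- factorial, matched by the ordinary hooks; the other is matched by the mixed hooks.
  have hw1 : ∀ i, weight a K σ (bead K lam i - σ) =
      (GammaList a (K - (bead K lam i - σ)))⁻¹ *
        (((bead K lam i).factorial : ℂ) * Complex.Gamma (bead K lam i + 1 - 2 * σ))⁻¹ ^ 2 := by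
    intro i
    have e1 : (bead K lam i : ℂ) - σ + 1 + σ = bead K lam i + 1 := by ring
    have e2 : (bead K lam i : ℂ) - σ + 1 - σ = bead K lam i + 1 - 2 * σ := by ring
    rw [weight, e1, e2, Complex.Gamma_nat_eq_factorial, one_div, mul_inv, mul_inv, mul_inv, mul_pow,
      inv_pow, inv_pow, mul_assoc]
  have hw2 : ∀ i, weight a K σ (bead K mu i + σ) =
      (GammaList a (K - (bead K mu i + σ)))⁻¹ *
        (((bead K mu i).factorial : ℂ) * Complex.Gamma (bead K mu i + 1 + 2 * σ))⁻¹ ^ 2 := by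
    intro i
    have e1 : (bead K mu i : ℂ) + σ + 1 + σ = bead K mu i + 1 + 2 * σ := by ring
    have e2 : (bead K mu i : ℂ) + σ + 1 - σ = bead K mu i + 1 := by ring
    rw [weight, e1, e2, Complex.Gamma_nat_eq_factorial]
    ring
  have hG1 : ∏ i, Complex.Gamma (bead K lam i + 1 - 2 * σ) ≠ 0 := by
    refine prod_ne_zero_iff.2 fun i _ => Complex.Gamma_ne_zero fun k h => ?_
    exact hnz (-(bead K lam i + 1 + k)) (by push_cast; linear_combination -h)
  have hG2 : ∏ i, Complex.Gamma (bead K mu i + 1 + 2 * σ) ≠ 0 := by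
    refine prod_ne_zero_iff.2 fun i _ => Complex.Gamma_ne_zero fun k h => ?_
    exact hnz (bead K mu i + 1 + k) (by push_cast; linear_combination h)
  have hF1 : ∏ i, ((bead K lam i).factorial : ℂ) ≠ 0 :=
    prod_ne_zero_iff.2 fun i _ => by exact_mod_cast Nat.factorial_ne_zero _
  have hF2 : ∏ i, ((bead K mu i).factorial : ℂ) ≠ 0 :=
    prod_ne_zero_iff.2 fun i _ => by exact_mod_cast Nat.factorial_ne_zero _
  have hQ : Q a K σ = (GList a (K + 1 + σ) / GList a (1 + σ)) *
      (GList a (K + 1 - σ) / GList a (1 - σ)) *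
      (Complex.Gamma (2 * σ) * Complex.Gamma (1 - 2 * σ)) ^ (2 * K) := by
    rw [Q, mul_pow, div_mul_div_comm, mul_assoc]
  rw [prod_mul_distrib, mul_pow] at hX
  -- No mixed hook vanishes, since the squared identity equates their product, times other factors,
  -- with nonzero Gamma values.
  have hN : (∏ c ∈ lam.cells, (mixedHook lam mu c + 2 * σ)) ≠ 0 ∧
      (∏ c ∈ mu.cells, (mixedHook mu lam c - 2 * σ)) ≠ 0 := by
    have h0 : _ ≠ (0 : ℂ) := hX ▸ pow_ne_zero 2 (mul_ne_zero hG2 hG1)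
    have h1 := left_ne_zero_of_mul (left_ne_zero_of_mul h0)
    rw [mul_ne_zero_iff] at h1
    exact ⟨fun h => h1.1 (by simp [h]), fun h => h1.2 (by simp [h])⟩
  simp only [blockCoeff, prod_div_distrib, prod_mul_distrib, prod_pow, hP1, hP2, hw1, hw2, hQ,
    prod_inv_distrib]
  obtain ⟨hN1, hN2⟩ := hN
  rw [← hH1, ← hH2]
  have hV1 := hF1
  have hV2 := hF2
  rw [← hH1] at hV1
  rw [← hH2] at hV2
  have hV1 := right_ne_zero_of_mul hV1
  have hV2 := right_ne_zero_of_mul hV2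
  generalize (∏ i, ∏ k ∈ Ioi i, ((bead K lam i : ℂ) - bead K lam k)) = V1 at *
  generalize (∏ i, ∏ k ∈ Ioi i, ((bead K mu i : ℂ) - bead K mu k)) = V2 at *
  generalize (∏ i, ∏ k, ((bead K mu i : ℂ) + 2 * σ - bead K lam k)) = V3 at *
  generalize (∏ c ∈ lam.cells, (mixedHook lam mu c + 2 * σ)) = N1 at *
  generalize (∏ c ∈ mu.cells, (mixedHook mu lam c - 2 * σ)) = N2 at *
  generalize ∏ i, Complex.Gamma (bead K lam i + 1 - 2 * σ) = G1 at *
  generalize ∏ i, Complex.Gamma (bead K mu i + 1 + 2 * σ) = G2 at *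
  generalize (Complex.Gamma (2 * σ) * Complex.Gamma (1 - 2 * σ)) ^ (2 * K) = R at *
  generalize (∏ c ∈ lam.cells, hook lam c) = H1 at *
  generalize (∏ c ∈ mu.cells, hook mu c) = H2 at *
  generalize GList a (K + 1 + σ) / GList a (1 + σ) = A at *
  generalize GList a (K + 1 - σ) / GList a (1 - σ) = B at *
  generalize (∏ i, GammaList a (K - (bead K lam i - σ)))⁻¹ = C at *
  generalize (∏ i, GammaList a (K - (bead K mu i + σ)))⁻¹ = D at *
  have hR : R * V3 ^ 2 = (G2 * G1) ^ 2 / (N1 * N2) ^ 2 := by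
    rw [eq_div_iff (by positivity)]
    linear_combination hX
  calc _ = A * B * C * D / (H1 ^ 2 * H2 ^ 2 * (G1 * G2) ^ 2) * ((G2 * G1) ^ 2 / (N1 * N2) ^ 2) := by
        field_simp
    _ = _ := by
      rw [← hR]
      field_simp

end PainleveBlock

/-! ### Regularity of the moment generating function up to the boundary -/

namespace PainleveBlock
open Filter Topology

lemma iteratedDerivWithin_eq_of_hasDerivWithinAt {S : Set ℂ} (hS : UniqueDiffOn ℂ S)
    {g : ℕ → ℂ → ℂ} {N : ℕ}
    (hg : ∀ n < N, ∀ v ∈ S, HasDerivWithinAt (g n) (g (n + 1) v) S v) {n : ℕ} (hn : n ≤ N) :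
    ∀ v ∈ S, iteratedDerivWithin n (g 0) S v = g n v := by
  induction n with
  | zero => intro v _; rw [iteratedDerivWithin_zero]
  | succ n ih =>
    intro v hv
    rw [iteratedDerivWithin_succ, derivWithin_congr (ih (by omega)) (ih (by omega) v hv)]
    exact (hg n (by omega) v hv).derivWithin (hS v hv)

lemma contDiffOn_of_hasDerivWithinAt {S : Set ℂ} (hS : UniqueDiffOn ℂ S)
    {g : ℕ → ℂ → ℂ} {N : ℕ}
    (hg : ∀ n < N, ∀ v ∈ S, HasDerivWithinAt (g n) (g (n + 1) v) S v)
    (hc : ContinuousOn (g N) S) : ContDiffOn ℂ (N : ℕ) (g 0) S := by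
  rw [contDiffOn_nat_iff_continuousOn_differentiableOn_deriv hS]
  constructor
  · intro m hm
    refine ContinuousOn.congr ?_ (iteratedDerivWithin_eq_of_hasDerivWithinAt hS hg hm)
    rcases hm.eq_or_lt with rfl | hm
    · exact hc
    · exact fun v hv => (hg m hm v hv).continuousWithinAt
  · intro m hm
    refine DifferentiableOn.congr ?_ (iteratedDerivWithin_eq_of_hasDerivWithinAt hS hg hm.le)
    exact fun v hv => (hg m hm v hv).differentiableWithinAt

lemma uniqueDiffOn_re_le (c : ℝ) : UniqueDiffOn ℂ {v : ℂ | v.re ≤ c} := by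
  refine uniqueDiffOn_convex_of_isRCLikeNormedField (convex_halfSpace_re_le c) ?_
  rw [Complex.interior_setOfPred_re_le]
  exact ⟨((c - 1 : ℝ) : ℂ), by simp⟩

section ExpSum

variable {w z : ℕ → ℂ} {s : ℂ}

/-- The `n`-th moment `∑ₖ wₖ zₖⁿ exp(v zₖ)`. -/
noncomputable def expSum (w z : ℕ → ℂ) (n : ℕ) (v : ℂ) : ℂ :=
  ∑' k, w k * (z k ^ n * Complex.exp (v * z k))

/-- Absolute convergence of the `n`-th moment of the points `zₖ ∈ ℕ + s` on the line `Re v = c`. -/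
def MomentSummable (w z : ℕ → ℂ) (n : ℕ) (c : ℝ) : Prop :=
  Summable fun k => ‖w k‖ * ‖z k‖ ^ n * Real.exp (c * k)

lemma norm_expSum_term (hz : ∀ k, z k = k + s) (n k : ℕ) (v : ℂ) :
    ‖w k * (z k ^ n * Complex.exp (v * z k))‖ =
      ‖w k‖ * ‖z k‖ ^ n * Real.exp (v.re * k) * Real.exp (v * s).re := by
  have : (v * z k).re = v.re * k + (v * s).re := by
    rw [hz, mul_add, Complex.add_re]; simp
  rw [norm_mul, norm_mul, norm_pow, Complex.norm_exp, this, Real.exp_add]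
  ring

lemma summable_expSum_iff (hz : ∀ k, z k = k + s) (n : ℕ) (v : ℂ) :
    Summable (fun k => w k * (z k ^ n * Complex.exp (v * z k))) ↔ MomentSummable w z n v.re := by
  rw [← summable_norm_iff]
  simp only [norm_expSum_term hz]
  exact summable_mul_right_iff (Real.exp_pos _).ne'

lemma MomentSummable.mono {n : ℕ} {c c' : ℝ} (h : MomentSummable w z n c') (hc : c ≤ c') :
    MomentSummable w z n c := by
  refine Summable.of_nonneg_of_le (fun k => by positivity) (fun k => ?_) h
  gcongr

/-- The gap `ε = c' - c` pays for any power of `zₖ`, through `x ^ n ≤ n! / ε ^ n * exp (ε x)`. -/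
lemma MomentSummable.of_lt (hz : ∀ k, z k = k + s) {c c' : ℝ} (h : MomentSummable w z 0 c')
    (hc : c < c') (n : ℕ) : MomentSummable w z n c := by
  set ε := c' - c with hε
  have hε0 : 0 < ε := sub_pos.2 hc
  refine Summable.of_nonneg_of_le (fun k => by positivity) (fun k => ?_)
    (h.mul_left (n.factorial / ε ^ n * Real.exp (ε * ‖s‖)))
  have h1 : ‖z k‖ ≤ k + ‖s‖ := by
    rw [hz]
    refine (norm_add_le _ _).trans ?_
    rw [Complex.norm_natCast]
  have h2 : ‖z k‖ ^ n ≤ n.factorial / ε ^ n * Real.exp (ε * (k + ‖s‖)) := by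
    have h3 := Real.pow_div_factorial_le_exp (ε * (k + ‖s‖)) (by positivity) n
    rw [div_le_iff₀ (by positivity), mul_pow] at h3
    rw [div_mul_eq_mul_div, le_div_iff₀ (by positivity)]
    calc ‖z k‖ ^ n * ε ^ n ≤ (k + ‖s‖) ^ n * ε ^ n := by gcongr
      _ ≤ _ := by linarith
  calc ‖w k‖ * ‖z k‖ ^ n * Real.exp (c * k)
      ≤ ‖w k‖ * (n.factorial / ε ^ n * Real.exp (ε * (k + ‖s‖))) * Real.exp (c * k) := by gcongr
    _ = n.factorial / ε ^ n * Real.exp (ε * ‖s‖) * (‖w k‖ * (Real.exp (ε * k) * Real.exp (c * k))) := by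
        rw [mul_add, Real.exp_add]; ring
    _ = _ := by
        rw [← Real.exp_add, pow_zero, mul_one]
        congr 3
        rw [hε]; ring

/-- A majorant uniform in `v'` near `v`, boundary line included, as needed for dominated
convergence. -/
lemma norm_expSum_term_le (hz : ∀ k, z k = k + s) (n k : ℕ) {c : ℝ} {v v' : ℂ}
    (hv : v'.re ≤ c) (hv' : v' ∈ Metric.ball v 1) :
    ‖w k * (z k ^ n * Complex.exp (v' * z k))‖ ≤
      ‖w k‖ * ‖z k‖ ^ n * Real.exp (c * k) * Real.exp ((‖v‖ + 1) * ‖s‖) := by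
  rw [norm_expSum_term hz]
  have : (v' * s).re ≤ (‖v‖ + 1) * ‖s‖ := by
    refine (Complex.re_le_norm _).trans ?_
    rw [norm_mul]
    gcongr
    rw [mem_ball_iff_norm] at hv'
    have := norm_le_norm_add_norm_sub v v'
    rw [norm_sub_rev] at this
    linarith
  gcongr

lemma continuousOn_expSum (hz : ∀ k, z k = k + s) {n : ℕ} {c : ℝ} (h : MomentSummable w z n c) :
    ContinuousOn (expSum w z n) {v : ℂ | v.re ≤ c} := by
  intro v hv
  refine tendsto_tsum_of_dominated_convergence (h.mul_right (Real.exp ((‖v‖ + 1) * ‖s‖))) ?_ ?_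
  · intro k
    refine (Continuous.tendsto ?_ v).mono_left nhdsWithin_le_nhds
    fun_prop
  · filter_upwards [self_mem_nhdsWithin, mem_nhdsWithin_of_mem_nhds (Metric.ball_mem_nhds v one_pos)]
      with y hy hy' k
    exact norm_expSum_term_le hz n k hy hy'

lemma hasDerivWithinAt_expSum (hz : ∀ k, z k = k + s) {n : ℕ} {c : ℝ}
    (h : MomentSummable w z n c) (h' : MomentSummable w z (n + 1) c) {v : ℂ} (hv : v.re ≤ c) :
    HasDerivWithinAt (expSum w z n) (expSum w z (n + 1) v) {v : ℂ | v.re ≤ c} v := by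
  have hd : ∀ k y, HasDerivAt (fun y => w k * (z k ^ n * Complex.exp (y * z k)))
      (w k * (z k ^ (n + 1) * Complex.exp (y * z k))) y := by
    intro k y
    have := ((((hasDerivAt_id y).mul_const (z k)).cexp).const_mul (z k ^ n)).const_mul (w k)
    refine this.congr_deriv ?_
    rw [id, pow_succ]
    ring
  rw [hasDerivWithinAt_iff_tendsto_slope]
  have hlim : Tendsto (fun y => ∑' k, slope (fun y => w k * (z k ^ n * Complex.exp (y * z k))) v y)
      (𝓝[{v : ℂ | v.re ≤ c} \ {v}] v) (𝓝 (expSum w z (n + 1) v)) := by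
    refine tendsto_tsum_of_dominated_convergence
      (h'.mul_right (Real.exp ((‖v‖ + 1) * ‖s‖))) ?_ ?_
    · intro k
      exact (hasDerivWithinAt_iff_tendsto_slope.1 (hd k v).hasDerivWithinAt)
    · filter_upwards [self_mem_nhdsWithin,
        mem_nhdsWithin_of_mem_nhds (Metric.ball_mem_nhds v one_pos)] with y hy hy' k
      -- The mean value inequality on the convex set (half-plane ∩ ball) bounds each difference
      -- quotient by the majorant of the next moment.
      have := Convex.norm_image_sub_le_of_norm_hasDerivWithin_le
        (s := {v : ℂ | v.re ≤ c} ∩ Metric.ball v 1)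
        (f := fun y => w k * (z k ^ n * Complex.exp (y * z k)))
        (fun x _ => (hd k x).hasDerivWithinAt)
        (fun x hx => norm_expSum_term_le (w := w) hz (n + 1) k hx.1 hx.2)
        ((convex_halfSpace_re_le c).inter (convex_ball v 1))
        ⟨hv, Metric.mem_ball_self one_pos⟩ ⟨hy.1, hy'⟩
      have hne : 0 < ‖y - v‖ := norm_pos_iff.2 (sub_ne_zero.2 hy.2)
      rw [slope_def_field, norm_div, div_le_iff₀ hne]
      exact this
  refine hlim.congr' ?_
  filter_upwards [self_mem_nhdsWithin] with y hy
  have hs : ∀ x : ℂ, x.re ≤ c → Summable (fun k => w k * (z k ^ n * Complex.exp (x * z k))) :=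
    fun x hx => (summable_expSum_iff hz n x).2 (h.mono hx)
  simp only [slope_def_field, expSum]
  rw [tsum_div_const, (hs y hy.1).tsum_sub (hs v hv)]

end ExpSum

section Mgf

variable {p : ℕ} (a : Fin p → ℂ) (K : ℕ) (σ u : ℂ)

lemma nuIntegrable_iff (n : ℕ) (v : ℂ) :
    NuIntegrable a K σ (fun z => z ^ n * Complex.exp (v * z)) ↔
      MomentSummable (fun k => weight a K σ (k + σ)) (fun k => k + σ) n v.re ∧
      MomentSummable (fun k => weight a K σ (k - σ)) (fun k => k - σ) n v.re :=
  and_congr (summable_expSum_iff (w := fun k => weight a K σ (k + σ)) (fun _ => rfl) n v)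
    (summable_expSum_iff (w := fun k => weight a K σ (k - σ)) (s := -σ)
      (fun _ => sub_eq_add_neg _ _) n v)

lemma mem_mgfDomain_iff (v : ℂ) : v ∈ mgfDomain a K σ ↔
      MomentSummable (fun k => weight a K σ (k + σ)) (fun k => k + σ) 0 v.re ∧
      MomentSummable (fun k => weight a K σ (k - σ)) (fun k => k - σ) 0 v.re := by
  rw [← nuIntegrable_iff]
  simp [mgfDomain]

variable {a K σ u}

/-- Convergence depends only on `Re v` and persists to the left. Either the domain reaches beyond
`Re u`, and any slightly larger `c` gives a neighbourhood of `u` on which all moments converge, or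
`u` is a boundary point and the domain is exactly the closed half-plane through `u`. Agreement near
`u` suffices, as derivatives within a set are local. -/
lemma exists_halfPlane_eventuallyEq_mgfDomain {N : ℕ}
    (hu : ∀ n ≤ N, NuIntegrable a K σ (fun z => z ^ n * Complex.exp (u * z))) :
    ∃ c : ℝ, u.re ≤ c ∧ {v : ℂ | v.re ≤ c} =ᶠ[𝓝 u] mgfDomain a K σ ∧
      ∀ n ≤ N, MomentSummable (fun k => weight a K σ (k + σ)) (fun k => k + σ) n c ∧
        MomentSummable (fun k => weight a K σ (k - σ)) (fun k => k - σ) n c := by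
  simp only [nuIntegrable_iff] at hu
  by_cases h : ∃ v ∈ mgfDomain a K σ, u.re < v.re
  · obtain ⟨v, hv, huv⟩ := h
    rw [mem_mgfDomain_iff] at hv
    obtain ⟨c, huc, hcv⟩ := exists_between huv
    have hS := fun n => And.intro (MomentSummable.of_lt (fun _ => rfl) hv.1 hcv n)
      (MomentSummable.of_lt (s := -σ) (fun _ => sub_eq_add_neg _ _) hv.2 hcv n)
    have hnhds : {y : ℂ | y.re ≤ c} ∈ 𝓝 u :=
      mem_of_superset ((isOpen_lt Complex.continuous_re continuous_const).mem_nhds huc)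
        fun y (hy : y.re < c) => hy.le
    refine ⟨c, huc.le, ?_, fun n _ => hS n⟩
    refine eventuallyEq_set.2 ?_
    filter_upwards [hnhds] with y hy
    refine iff_of_true hy ((mem_mgfDomain_iff a K σ y).2 ?_)
    exact ⟨(hS 0).1.mono hy, (hS 0).2.mono hy⟩
  · push Not at h
    refine ⟨u.re, le_rfl, ?_, hu⟩
    refine Eventually.of_forall fun y => propext ⟨fun hy => ?_, fun hy => h y hy⟩
    have h0 := hu 0 (Nat.zero_le _)
    exact (mem_mgfDomain_iff a K σ y).2 ⟨h0.1.mono hy, h0.2.mono hy⟩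

lemma mgf_hasDerivs {N : ℕ} {c : ℝ}
    (hc : ∀ n ≤ N, MomentSummable (fun k => weight a K σ (k + σ)) (fun k => k + σ) n c ∧
        MomentSummable (fun k => weight a K σ (k - σ)) (fun k => k - σ) n c) (q : ℂ) :
    (∀ n < N, ∀ v ∈ {v : ℂ | v.re ≤ c}, HasDerivWithinAt
      (fun v => nuIntegral a K σ q fun z => z ^ n * Complex.exp (v * z))
      (nuIntegral a K σ q fun z => z ^ (n + 1) * Complex.exp (v * z)) {v : ℂ | v.re ≤ c} v) ∧
    ContinuousOn (fun v => nuIntegral a K σ q fun z => z ^ N * Complex.exp (v * z))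
      {v : ℂ | v.re ≤ c} := by
  constructor
  · intro n hn v hv
    have h1 := hc n hn.le
    have h2 := hc (n + 1) hn
    exact ((hasDerivWithinAt_expSum (fun _ => rfl) h1.1 h2.1 hv).const_mul q).add
      ((hasDerivWithinAt_expSum (s := -σ) (fun _ => sub_eq_add_neg _ _) h1.2 h2.2 hv).const_mul q⁻¹)
  · have h1 := hc N le_rfl
    exact ((continuousOn_expSum (fun _ => rfl) h1.1).const_mul q).add
      ((continuousOn_expSum (s := -σ) (fun _ => sub_eq_add_neg _ _) h1.2).const_mul q⁻¹)

lemma mgf_eq (q : ℂ) :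
    mgf a K σ q = fun v => nuIntegral a K σ q fun z => z ^ 0 * Complex.exp (v * z) := by
  simp [mgf, funext_iff]

theorem contDiffWithinAt_mgf {N : ℕ}
    (hu : ∀ n ≤ N, NuIntegrable a K σ (fun z => z ^ n * Complex.exp (u * z))) (q : ℂ) :
    ContDiffWithinAt ℂ (N : ℕ) (mgf a K σ q) (mgfDomain a K σ) u := by
  obtain ⟨c, huc, heq, hc⟩ := exists_halfPlane_eventuallyEq_mgfDomain hu
  obtain ⟨h1, h2⟩ := mgf_hasDerivs hc q
  refine ContDiffWithinAt.congr_set ?_ heq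
  rw [mgf_eq]
  exact contDiffOn_of_hasDerivWithinAt (uniqueDiffOn_re_le c)
    (g := fun n v => nuIntegral a K σ q fun z => z ^ n * Complex.exp (v * z)) h1 h2 u huc

/-- The derivatives of the moment generating function are the differentiated integrals. -/
theorem mgfDeriv_eq {N : ℕ}
    (hu : ∀ n ≤ N, NuIntegrable a K σ (fun z => z ^ n * Complex.exp (u * z))) (q : ℂ) {n : ℕ}
    (hn : n ≤ N) :
    mgfDeriv a K σ q n u = nuIntegral a K σ q (fun z => z ^ n * Complex.exp (u * z)) := by
  obtain ⟨c, huc, heq, hc⟩ := exists_halfPlane_eventuallyEq_mgfDomain hu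
  obtain ⟨h1, h2⟩ := mgf_hasDerivs hc q
  have := iteratedDerivWithin_eq_of_hasDerivWithinAt (uniqueDiffOn_re_le c)
    (g := fun n v => nuIntegral a K σ q fun z => z ^ n * Complex.exp (v * z)) h1 hn u huc
  rw [← this, mgfDeriv, mgf_eq, iteratedDerivWithin, iteratedDerivWithin,
    iteratedFDerivWithin_congr_set heq]

end Mgf

end PainleveBlock

/-! ### Balanced configurations and pairs of partitions -/

namespace PainleveBlock
open Finset

/-- Every strictly decreasing sequence of naturals comes from a partition. -/
lemma exists_bead_eq {K : ℕ} (l : Fin K → ℕ) (hl : StrictAnti l) :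
    ∃ lam : YoungDiagram, length lam ≤ K ∧ bead K lam = l := by
  -- A strictly decreasing integer sequence drops by at least one per step. This makes the row
  -- lengths `l i - (K - 1 - i)` weakly decreasing and the truncated subtraction exact.
  have hstep : ∀ (d : ℕ) (i k : Fin K), (i : ℕ) + d = k → l k + d ≤ l i := by
    intro d
    induction d with
    | zero => intro i k h; rw [add_zero, Fin.ext (a := i) (b := k) (by simpa using h)]
    | succ d ih =>
      intro i k h
      have h1 := ih i ⟨i + d, by omega⟩ rfl
      have h2 : l k < l ⟨i + d, by omega⟩ := hl (by rw [Fin.lt_def]; dsimp only; omega)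
      omega
  let r : Fin K → ℕ := fun i => l i - (K - 1 - i)
  let cells : Finset (ℕ × ℕ) :=
    univ.biUnion fun i : Fin K => (range (r i)).image fun j => ((i : ℕ), j)
  have hmem : ∀ i j, (i, j) ∈ cells ↔ ∃ h : i < K, j < r ⟨i, h⟩ := by
    intro i j
    simp only [cells, mem_biUnion, mem_univ, true_and, mem_image, mem_range,
      Prod.mk.injEq]
    constructor
    · rintro ⟨i', j', hj, rfl, rfl⟩
      exact ⟨i'.2, hj⟩
    · rintro ⟨h, hj⟩
      exact ⟨⟨i, h⟩, j, hj, rfl, rfl⟩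
  have hlower : IsLowerSet (cells : Set (ℕ × ℕ)) := by
    rintro ⟨i, j⟩ ⟨i', j'⟩ hle hin
    rw [Prod.mk_le_mk] at hle
    rw [mem_coe, hmem] at hin ⊢
    obtain ⟨h, hj⟩ := hin
    refine ⟨hle.1.trans_lt h, ?_⟩
    have := hstep (i - i') ⟨i', hle.1.trans_lt h⟩ ⟨i, h⟩ (by dsimp only; omega)
    dsimp only [r] at hj ⊢
    omega
  refine ⟨⟨cells, hlower⟩, ?_, ?_⟩
  · by_contra hlen
    have : (K, 0) ∈ (⟨cells, hlower⟩ : YoungDiagram) :=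
      YoungDiagram.mem_iff_lt_colLen.2 (not_le.1 hlen)
    rw [YoungDiagram.mem_mk, hmem] at this
    exact lt_irrefl _ this.1
  · funext i
    have hr : YoungDiagram.rowLen ⟨cells, hlower⟩ i = r i := by
      refine eq_of_forall_lt_iff fun j => ?_
      rw [← YoungDiagram.mem_iff_lt_rowLen, YoungDiagram.mem_mk, hmem]
      exact ⟨fun h => h.2, fun h => ⟨i.2, h⟩⟩
    have := hstep (K - 1 - i) i ⟨K - 1, by have := i.2; omega⟩ (by dsimp only; omega)
    rw [bead, hr]
    dsimp only [r]
    omega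

lemma bead_injective {K : ℕ} {lam mu : YoungDiagram} (hl : length lam ≤ K) (hm : length mu ≤ K)
    (h : bead K lam = bead K mu) : lam = mu := by
  have hr : ∀ i < K, lam.rowLen i = mu.rowLen i := by
    intro i hi
    have := congrFun h ⟨i, hi⟩
    unfold bead at this
    dsimp only at this
    omega
  ext ⟨i, j⟩
  rw [YoungDiagram.mem_cells, YoungDiagram.mem_cells]
  by_cases hi : i < K
  · rw [YoungDiagram.mem_iff_lt_rowLen, YoungDiagram.mem_iff_lt_rowLen, hr i hi]
  · exact iff_of_false (fun hc => hi (mem_fst_lt hl hc)) fun hc => hi (mem_fst_lt hm hc)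

/-- The exponent of `q` carried by a point of the support of `ν`; `Sum.inl k` stands for `k + σ` and
`Sum.inr k` for `k - σ`. -/
def charge : ℕ ⊕ ℕ → ℤ := Sum.elim (fun _ => 1) fun _ => -1

/-- The configuration of `K + K` support points of `ν` attached to a pair of partitions. -/
def config (K : ℕ) (x : RestrictedPairs K) : Fin K ⊕ Fin K → ℕ ⊕ ℕ :=
  Sum.map (bead K x.1.2) (bead K x.1.1)

lemma config_injective (K : ℕ) (x : RestrictedPairs K) : Function.Injective (config K x) :=
  (bead_strictAnti K _).injective.sumMap (bead_strictAnti K _).injective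

/-- The range of the tuple determines both bead sets, hence both partitions; the ordering is then
recovered because the points of a configuration are distinct. -/
lemma config_comp_injective (K n : ℕ) : Function.Injective
    fun xe : RestrictedPairs K × (Fin n ≃ Fin K ⊕ Fin K) => config K xe.1 ∘ xe.2 := by
  rintro ⟨x, e⟩ ⟨x', e'⟩ h
  dsimp only at h
  have hrange : Set.range (config K x) = Set.range (config K x') := by
    rw [← e.surjective.range_comp (config K x), ← e'.surjective.range_comp (config K x'), h]
  have h2 : bead K x.1.2 = bead K x'.1.2 := by
    rw [← StrictAnti.range_inj (bead_strictAnti K _) (bead_strictAnti K _)]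
    ext k
    have := Set.ext_iff.1 hrange (Sum.inl k)
    simpa [config] using this
  have h1 : bead K x.1.1 = bead K x'.1.1 := by
    rw [← StrictAnti.range_inj (bead_strictAnti K _) (bead_strictAnti K _)]
    ext k
    have := Set.ext_iff.1 hrange (Sum.inr k)
    simpa [config] using this
  have hx : x = x' := by
    apply Subtype.ext
    exact Prod.ext (bead_injective x.2.1 x'.2.1 h1) (bead_injective x.2.2 x'.2.2 h2)
  subst hx
  have he : e = e' := by
    ext i
    rw [config_injective K x (congrFun h i)]
  rw [he]

lemma sum_charge_config (K n : ℕ) (x : RestrictedPairs K) (e : Fin n ≃ Fin K ⊕ Fin K) :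
    ∑ i, charge (config K x (e i)) = 0 := by
  rw [e.sum_comp fun s => charge (config K x s), Fintype.sum_sum_type]
  simp [charge, config]

/-- The `2K` distinct points split into two kinds, and total charge zero forces `K` of each; sorting
each kind decreasingly gives the beads of a partition. -/
lemma exists_config_comp_eq {K : ℕ} {f : Fin (2 * K) → ℕ ⊕ ℕ} (hf : Function.Injective f)
    (hc : ∑ i, charge (f i) = 0) :
    ∃ xe : RestrictedPairs K × (Fin (2 * K) ≃ Fin K ⊕ Fin K), config K xe.1 ∘ xe.2 = f := by
  classical
  set s : Finset (ℕ ⊕ ℕ) := univ.image f with hs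
  have hcard : #s.toLeft + #s.toRight = 2 * K := by
    rw [card_toLeft_add_card_toRight, hs, card_image_of_injective _ hf, card_univ, Fintype.card_fin]
  have hdiff : (#s.toLeft : ℤ) - #s.toRight = 0 := by
    rw [← hc, ← sum_image (f := charge) (s := univ) (g := f) hf.injOn, ← hs,
      ← toLeft_disjSum_toRight (u := s), sum_disjSum, toLeft_disjSum, toRight_disjSum]
    simp [charge, sub_eq_add_neg]
  have hL : #s.toLeft = K := by omega
  have hR : #s.toRight = K := by omega
  have hanti : ∀ (t : Finset ℕ) (ht : #t = K), StrictAnti (t.orderEmbOfFin ht ∘ Fin.rev) :=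
    fun t ht i k hik => (t.orderEmbOfFin ht).strictMono (Fin.rev_lt_rev.2 hik)
  have hrange : ∀ (t : Finset ℕ) (ht : #t = K), Set.range (t.orderEmbOfFin ht ∘ Fin.rev) = t :=
    fun t ht => by rw [Fin.rev_surjective.range_comp, range_orderEmbOfFin]
  obtain ⟨mu, hmu, hmu'⟩ := exists_bead_eq _ (hanti _ hL)
  obtain ⟨lam, hlam, hlam'⟩ := exists_bead_eq _ (hanti _ hR)
  let x : RestrictedPairs K := ⟨(lam, mu), hlam, hmu⟩
  have hg : Set.range f = Set.range (config K x) := by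
    have h1 : Set.range f = (s : Set (ℕ ⊕ ℕ)) := by simp [hs]
    rw [h1, ← toLeft_disjSum_toRight (u := s)]
    ext (k | k)
    · have := Set.ext_iff.1 (hrange _ hL) k
      rw [← hmu'] at this
      simpa [config, x] using this.symm
    · have := Set.ext_iff.1 (hrange _ hR) k
      rw [← hlam'] at this
      simpa [config, x] using this.symm
  refine ⟨(x, ((Equiv.ofInjective f hf).trans (Equiv.setCongr hg)).trans
    (Equiv.ofInjective _ (config_injective K x)).symm), ?_⟩
  funext i
  simp only [Function.comp_apply, Equiv.trans_apply]
  rw [Equiv.apply_ofInjective_symm (config_injective K x)]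
  rfl

end PainleveBlock

/-! ### Hankel determinants, Vandermonde squares and the circle integral -/

namespace PainleveBlock
open Finset

lemma hasSum_prod_apply {X : Type*} {n : ℕ} (g : Fin n → X → ℂ) (hg : ∀ i, Summable (g i)) :
    HasSum (fun f : Fin n → X => ∏ i, g i (f i)) (∏ i, ∑' x, g i x) := by
  induction n with
  | zero => simp
  | succ n ih =>
    rw [Fin.prod_univ_succ]
    have h1 := ih (fun i => g i.succ) fun i => hg i.succ
    have h3 : Summable fun xf : X × (Fin n → X) => g 0 xf.1 * ∏ i, g (Fin.succ i) (xf.2 i) :=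
      summable_mul_of_summable_norm (f := g 0) (g := fun f : Fin n → X => ∏ i, g (Fin.succ i) (f i))
        (hg 0).norm h1.summable.norm
    have h2 := (hg 0).hasSum.mul h1 h3
    rw [← (Fin.consEquiv fun _ : Fin (n + 1) => X).hasSum_iff]
    refine h2.congr_fun fun xf => ?_
    simp only [Function.comp_apply, Fin.consEquiv_apply, Fin.prod_univ_succ, Fin.cons_zero,
      Fin.cons_succ]

/-- The expansion of a Hankel determinant of moments over tuples of points. -/
lemma hasSum_det_hankel {X : Type*} {n : ℕ} (b y : X → ℂ)
    (hb : ∀ i j : Fin n, Summable fun x => b x * y x ^ ((i : ℕ) + j)) :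
    HasSum (fun f : Fin n → X => (∏ i, b (f i)) * ((∏ i, y (f i) ^ (i : ℕ)) *
        (Matrix.vandermonde fun i => y (f i)).det))
      (Matrix.det (Matrix.of fun i j : Fin n => ∑' x, b x * y x ^ ((i : ℕ) + j))) := by
  rw [Matrix.det_apply']
  have h := hasSum_sum fun (τ : Equiv.Perm (Fin n)) (_ : τ ∈ univ) =>
    (hasSum_prod_apply (fun i x => b x * y x ^ ((τ i : ℕ) + i)) fun i => hb (τ i) i).mul_left
      ((Equiv.Perm.sign τ : ℤ) : ℂ)
  refine h.congr_fun fun f => ?_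
  -- For a fixed tuple, the powers `y ^ i` come out of the Leibniz sum, and what is left is the
  -- Leibniz expansion of a Vandermonde determinant.
  rw [← Matrix.det_transpose, Matrix.det_apply', mul_sum, mul_sum]
  refine sum_congr rfl fun τ _ => ?_
  simp only [Matrix.transpose_apply, Matrix.vandermonde_apply, pow_add, prod_mul_distrib]
  ring

/-- Permuting the points multiplies the Vandermonde determinant by the sign, and the remaining
signed sum of monomials is that determinant again. -/
lemma sum_perm_vandermonde {n : ℕ} (Y : Fin n → ℂ) :
    ∑ τ : Equiv.Perm (Fin n), (∏ i, Y (τ i) ^ (i : ℕ)) *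
      (Matrix.vandermonde fun i => Y (τ i)).det = (Matrix.vandermonde Y).det ^ 2 := by
  have : ∀ τ : Equiv.Perm (Fin n), (Matrix.vandermonde fun i => Y (τ i)).det =
      ((Equiv.Perm.sign τ : ℤ) : ℂ) * (Matrix.vandermonde Y).det :=
    fun τ => Matrix.det_permute τ (Matrix.vandermonde Y)
  rw [sq]
  nth_rewrite 2 [Matrix.det_apply']
  rw [mul_sum]
  refine sum_congr rfl fun τ _ => ?_
  rw [this]
  simp only [Matrix.vandermonde_apply]
  ring

lemma prod_Ioi_add {m n : ℕ} (f : Fin (m + n) → Fin (m + n) → ℂ) :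
    ∏ i, ∏ j ∈ Ioi i, f i j =
      (∏ i : Fin m, ∏ j ∈ Ioi i, f (i.castAdd n) (j.castAdd n)) *
      (∏ i : Fin n, ∏ j ∈ Ioi i, f (i.natAdd m) (j.natAdd m)) *
      ∏ i : Fin m, ∏ j : Fin n, f (i.castAdd n) (j.natAdd m) := by
  have hI : ∀ {N : ℕ} (i : Fin N) (g : Fin N → ℂ), ∏ j ∈ Ioi i, g j =
      ∏ j, if i < j then g j else 1 := by
    intro N i g
    rw [← prod_filter]
    congr 1
    ext j; simp
  simp only [hI, Fin.prod_univ_add]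
  have h1 : ∀ (i : Fin m) (j : Fin n), i.castAdd n < j.natAdd m := fun i j => by
    rw [Fin.lt_def]; simp; omega
  have h2 : ∀ (i : Fin n) (j : Fin m), ¬ i.natAdd m < j.castAdd n := fun i j => (h1 j i).not_gt
  have h3 : ∀ i j : Fin m, i.castAdd n < j.castAdd n ↔ i < j := fun _ _ => Iff.rfl
  simp only [h1, h2, h3, if_true, if_false, prod_const_one, one_mul, prod_mul_distrib,
    Fin.natAdd_lt_natAdd_iff]
  ring

lemma det_vandermonde_sumElim {K N : ℕ} (hN : N = K + K) (Y Z : Fin K → ℂ) :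
    (Matrix.vandermonde fun i : Fin N =>
      Sum.elim Y Z (((finCongr hN).trans finSumFinEquiv.symm) i)).det =
      (∏ i, ∏ j ∈ Ioi i, (Y j - Y i)) * (∏ i, ∏ j ∈ Ioi i, (Z j - Z i)) *
        ∏ i, ∏ j, (Z j - Y i) := by
  subst hN
  rw [Matrix.det_vandermonde, prod_Ioi_add]
  simp only [Equiv.trans_apply, finCongr_apply, Fin.cast_eq_self,
    finSumFinEquiv_symm_apply_castAdd, finSumFinEquiv_symm_apply_natAdd, Sum.elim_inl, Sum.elim_inr]

/-- All orderings arise from one reference ordering `e₀` by a permutation, so `sum_perm_vandermonde`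
applies; `e₀` lists the left block first, which splits the Vandermonde product into two blocks and a
cross term. -/
lemma sum_equiv_vandermonde {X : Type*} {K N : ℕ} (hN : N = K + K) (b y : X → ℂ)
    (g : Fin K ⊕ Fin K → X) :
    ∑ e : Fin N ≃ Fin K ⊕ Fin K, (∏ i, b (g (e i))) * ((∏ i, y (g (e i)) ^ (i : ℕ)) *
        (Matrix.vandermonde fun i => y (g (e i))).det) =
      (∏ s, b (g s)) * ((∏ i, ∏ j ∈ Ioi i, (y (g (Sum.inl j)) - y (g (Sum.inl i)))) *
        (∏ i, ∏ j ∈ Ioi i, (y (g (Sum.inr j)) - y (g (Sum.inr i)))) *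
        ∏ i, ∏ j, (y (g (Sum.inr j)) - y (g (Sum.inl i)))) ^ 2 := by
  have hb : ∀ e : Fin N ≃ Fin K ⊕ Fin K, ∏ i, b (g (e i)) = ∏ s, b (g s) :=
    fun e => e.prod_comp fun s => b (g s)
  simp only [hb]
  rw [← mul_sum]
  congr 1
  set e₀ : Fin N ≃ Fin K ⊕ Fin K := (finCongr hN).trans finSumFinEquiv.symm with he₀
  have h1 := det_vandermonde_sumElim hN (fun i => y (g (Sum.inl i))) fun i => y (g (Sum.inr i))
  have h2 : ∀ s, Sum.elim (fun i => y (g (Sum.inl i))) (fun i => y (g (Sum.inr i))) s = y (g s) := by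
    rintro (i | i) <;> rfl
  simp only [h2] at h1
  rw [← h1, ← he₀, ← sum_perm_vandermonde]
  let E : Equiv.Perm (Fin N) ≃ (Fin N ≃ Fin K ⊕ Fin K) :=
    ⟨fun τ => τ.trans e₀, fun e => e.trans e₀.symm, fun τ => by ext; simp, fun e => by ext; simp⟩
  exact (E.sum_comp _).symm

lemma prod_zpow_eq {n : ℕ} {q : ℂ} (hq : q ≠ 0) (c : Fin n → ℤ) :
    ∏ i, q ^ c i = q ^ ∑ i, c i := by
  induction n with
  | zero => simp
  | succ n ih => rw [Fin.prod_univ_succ, Fin.sum_univ_succ, ih, zpow_add₀ hq]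

/-- Integration over the unit circle selects the terms with exponent zero. -/
lemma hasSum_circleIntegral_zpow {F : Type*} [Countable F] (c : F → ℤ) (T : F → ℂ) (W : ℂ → ℂ)
    (hT : Summable T) (hW : ∀ q : ℂ, ‖q‖ = 1 → HasSum (fun f => q ^ c f * T f) (W q)) :
    HasSum (fun f => if c f = 0 then T f else 0)
      (1 / (2 * (π : ℂ) * Complex.I) * ∮ q in C(0, 1), W q / q) := by
  have hcirc : ∀ θ : ℝ, circleMap 0 1 θ ≠ 0 := fun θ => circleMap_ne_center one_ne_zero
  have hnorm : ∀ θ : ℝ, ‖circleMap 0 1 θ‖ = 1 := fun θ => by simp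
  have key : HasSum (fun f => ∮ q in C(0, 1), q ^ (c f - 1) * T f) (∮ q in C(0, 1), W q / q) := by
    -- On `|q| = 1` every power of `q` has modulus one, so `‖T f‖` dominates uniformly in the angle.
    refine intervalIntegral.hasSum_integral_of_dominated_convergence (fun f _ => ‖T f‖) ?_ ?_ ?_ ?_ ?_
    · intro f
      refine Continuous.aestronglyMeasurable ?_
      have h1 : Continuous fun θ : ℝ => circleMap 0 1 θ ^ (c f - 1) :=
        (continuous_circleMap 0 1).zpow₀ _ fun θ => Or.inl (hcirc θ)
      simp only [deriv_circleMap, smul_eq_mul]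
      exact ((continuous_circleMap 0 1).mul continuous_const).mul (h1.mul continuous_const)
    · intro f
      refine Filter.Eventually.of_forall fun θ _ => ?_
      simp only [deriv_circleMap, smul_eq_mul, norm_mul, norm_zpow, hnorm, Complex.norm_I]
      simp
    · exact Filter.Eventually.of_forall fun θ _ => hT.norm
    · exact intervalIntegrable_const
    · refine Filter.Eventually.of_forall fun θ _ => ?_
      have := ((hW _ (hnorm θ)).div_const (circleMap 0 1 θ)).mul_left (deriv (circleMap 0 1) θ)
      refine this.congr_fun fun f => ?_
      beta_reduce
      rw [smul_eq_mul, zpow_sub_one₀ (hcirc θ)]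
      ring
  have hpi : (2 * (π : ℂ) * Complex.I) ≠ 0 := by simp [Real.pi_ne_zero]
  refine (key.mul_left (1 / (2 * (π : ℂ) * Complex.I))).congr_fun fun f => ?_
  have hsm : (∮ q in C(0, 1), q ^ (c f - 1) * T f) = (∮ q in C(0, 1), q ^ (c f - 1)) * T f := by
    have := circleIntegral.integral_smul_const (fun q : ℂ => q ^ (c f - 1)) (T f) 0 1
    simpa using this
  rw [hsm]
  split_ifs with h
  · have := circleIntegral.integral_sub_center_inv 0 (one_ne_zero (α := ℝ))
    simp only [sub_zero] at this
    rw [h, zero_sub]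
    simp only [zpow_neg_one]
    rw [this]
    field_simp
  · have := circleIntegral.integral_sub_zpow_of_ne (n := c f - 1) (by omega) 0 0 1
    simp only [sub_zero] at this
    rw [this]
    simp

end PainleveBlock

/-! ### Expansion of the determinant of `ψ` and comparison with the block coefficients -/

namespace PainleveBlock
open Finset

/-- The support points `k + σ` and `k - σ` of `ν`. -/
def suppPoint (σ : ℂ) : ℕ ⊕ ℕ → ℂ := Sum.elim (fun k => k + σ) fun k => k - σ

/-- The mass of `e^{uz} dν(z)` at a support point, without the factor `q` or `q⁻¹`. -/
noncomputable def suppMass {p : ℕ} (a : Fin p → ℂ) (K : ℕ) (σ u : ℂ) (x : ℕ ⊕ ℕ) : ℂ :=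
  weight a K σ (suppPoint σ x) * Complex.exp (u * suppPoint σ x)

/-- The term with index `f` in the expansion of the Hankel determinant of the moments of `ν`,
without its power of `q`. -/
noncomputable def hankelTerm {p : ℕ} (a : Fin p → ℂ) (K : ℕ) (σ u : ℂ) {n : ℕ} (f : Fin n → ℕ ⊕ ℕ) : ℂ :=
  (∏ i, suppMass a K σ u (f i)) * ((∏ i, suppPoint σ (f i) ^ (i : ℕ)) *
    (Matrix.vandermonde fun i => suppPoint σ (f i)).det)

variable {p : ℕ} {a : Fin p → ℂ} {K : ℕ} {σ u : ℂ}

lemma hasSum_nuIntegral {q : ℂ} {n : ℕ}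
    (h : NuIntegrable a K σ (fun z => z ^ n * Complex.exp (u * z))) :
    HasSum (fun x => q ^ charge x * suppMass a K σ u x * suppPoint σ x ^ n)
      (nuIntegral a K σ q fun z => z ^ n * Complex.exp (u * z)) := by
  refine HasSum.sum ?_ ?_
  · refine (h.1.hasSum.mul_left q).congr_fun fun k => ?_
    simp only [Function.comp_apply, charge, suppMass, suppPoint, Sum.elim_inl, zpow_one]
    ring
  · refine (h.2.hasSum.mul_left q⁻¹).congr_fun fun k => ?_
    simp only [Function.comp_apply, charge, suppMass, suppPoint, Sum.elim_inr, zpow_neg_one]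
    ring

lemma wronskian_eq
    (hu : ∀ n ≤ 4 * K - 2, NuIntegrable a K σ (fun z => z ^ n * Complex.exp (u * z))) (q : ℂ) :
    wronskian a K σ q u = Matrix.det (Matrix.of fun i j : Fin (2 * K) =>
      nuIntegral a K σ q fun z => z ^ ((i : ℕ) + j) * Complex.exp (u * z)) := by
  rw [wronskian]
  congr 1
  ext i j
  rw [Matrix.of_apply, Matrix.of_apply, mgfDeriv_eq hu q (by omega)]

lemma hasSum_wronskian
    (hu : ∀ n ≤ 4 * K - 2, NuIntegrable a K σ (fun z => z ^ n * Complex.exp (u * z)))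
    {q : ℂ} (hq : q ≠ 0) :
    HasSum (fun f : Fin (2 * K) → ℕ ⊕ ℕ => q ^ (∑ i, charge (f i)) * hankelTerm a K σ u f)
      (wronskian a K σ q u) := by
  have hs : ∀ i j : Fin (2 * K), HasSum
      (fun x => q ^ charge x * suppMass a K σ u x * suppPoint σ x ^ ((i : ℕ) + j))
      (nuIntegral a K σ q fun z => z ^ ((i : ℕ) + j) * Complex.exp (u * z)) :=
    fun i j => hasSum_nuIntegral (hu _ (by omega))
  have h := hasSum_det_hankel (n := 2 * K) (fun x => q ^ charge x * suppMass a K σ u x)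
    (suppPoint σ) fun i j => (hs i j).summable
  simp only [fun i j => (hs i j).tsum_eq] at h
  rw [← wronskian_eq hu q] at h
  refine h.congr_fun fun f => ?_
  rw [prod_mul_distrib, prod_zpow_eq hq, hankelTerm]
  ring

lemma circleIntegrable_wronskian
    (hu : ∀ n ≤ 4 * K - 2, NuIntegrable a K σ (fun z => z ^ n * Complex.exp (u * z))) :
    CircleIntegrable (fun q => wronskian a K σ q u / q) 0 1 := by
  refine ContinuousOn.circleIntegrable zero_le_one ?_
  have h0 : ∀ q ∈ Metric.sphere (0 : ℂ) 1, q ≠ 0 := by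
    rintro q hq rfl
    simp at hq
  refine ContinuousOn.div ?_ continuousOn_id h0
  simp only [wronskian_eq hu]
  refine (Continuous.matrix_det continuous_id).comp_continuousOn ?_
  refine continuousOn_pi.2 fun i => continuousOn_pi.2 fun j => ?_
  exact (continuousOn_id.mul continuousOn_const).add
    ((continuousOn_id.inv₀ h0).mul continuousOn_const)

/-- The beads of each partition add up to its weight plus `K(K-1)/2`, and the shifts `±σ` cancel
because both kinds have `K` points. -/
lemma prod_suppMass (x : RestrictedPairs K) :
    ∏ s, suppMass a K σ u (config K x s) =
      (∏ i, weight a K σ (bead K x.1.1 i - σ)) * (∏ i, weight a K σ (bead K x.1.2 i + σ)) *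
        (Complex.exp (u * ((x.1.1.card : ℂ) + x.1.2.card)) * Complex.exp u ^ (K * (K - 1))) := by
  have hsum : ∑ i, ((bead K x.1.2 i : ℂ) + σ) + ∑ i, ((bead K x.1.1 i : ℂ) - σ) =
      x.1.1.card + x.1.2.card + (K * (K - 1) : ℕ) := by
    have h1 := two_mul_sum_bead x.2.1
    have h2 := two_mul_sum_bead x.2.2
    have h3 : ∑ i, bead K x.1.2 i + ∑ i, bead K x.1.1 i =
      x.1.1.card + x.1.2.card + K * (K - 1) := by omega
    rw [sum_add_distrib, sum_sub_distrib]
    have h4 := congrArg (Nat.cast (R := ℂ)) h3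
    rw [Nat.cast_add, Nat.cast_sum, Nat.cast_sum] at h4
    rw [add_add_sub_cancel, h4]
    push_cast
    rfl
  rw [← Complex.exp_nat_mul, ← Complex.exp_add, mul_comm _ u, ← mul_add, ← hsum, mul_add, mul_sum,
    mul_sum, Complex.exp_add, Complex.exp_sum, Complex.exp_sum, Fintype.prod_sum_type]
  simp only [suppMass, config, suppPoint, Sum.map_inl, Sum.map_inr, Sum.elim_inl, Sum.elim_inr,
    prod_mul_distrib]
  ring

/-- Differences of points of the same kind lose `σ`, those of opposite kinds acquire `2σ`; up to
signs removed by the square, these are the differences in `blockCoeff_eq`. -/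
lemma sum_hankelTerm (x : RestrictedPairs K) (hσ : ∀ n : ℤ, 2 * σ ≠ n)
    (ha : ∀ (i : Fin p) (n : ℕ), a i + σ ≠ -((n : ℂ) + 1) ∧ a i - σ ≠ -((n : ℂ) + 1)) :
    Q a K σ / Complex.exp u ^ (K * (K - 1)) *
      ∑ e : Fin (2 * K) ≃ Fin K ⊕ Fin K, hankelTerm a K σ u (config K x ∘ e) =
    blockCoeff a σ x.1.1 x.1.2 * Complex.exp (u * ((x.1.1.card : ℂ) + (x.1.2.card : ℂ))) := by
  have h := sum_equiv_vandermonde (two_mul K) (suppMass a K σ u) (suppPoint σ) (config K x)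
  simp only [hankelTerm, Function.comp_apply]
  rw [h, prod_suppMass, blockCoeff_eq a x.2.1 x.2.2 σ hσ ha]
  have hexp := pow_ne_zero (K * (K - 1)) (Complex.exp_ne_zero u)
  simp only [config, suppPoint, Sum.map_inl, Sum.map_inr, Sum.elim_inl, Sum.elim_inr,
    add_sub_add_right_eq_sub, sub_sub_sub_cancel_right]
  have hneg : ∀ l : Fin K → ℕ, (∏ i, ∏ j ∈ Ioi i, ((l j : ℂ) - l i)) ^ 2 =
      (∏ i, ∏ j ∈ Ioi i, ((l i : ℂ) - l j)) ^ 2 := by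
    intro l
    simp only [← prod_pow]
    exact prod_congr rfl fun i _ => prod_congr rfl fun j _ => by ring
  have hmix : (∏ i, ∏ j, ((bead K x.1.1 j : ℂ) - σ - (bead K x.1.2 i + σ))) ^ 2 =
      (∏ i, ∏ j, ((bead K x.1.2 i : ℂ) + 2 * σ - bead K x.1.1 j)) ^ 2 := by
    simp only [← prod_pow]
    exact prod_congr rfl fun i _ => prod_congr rfl fun j _ => by ring
  rw [mul_pow, mul_pow, mul_pow, mul_pow, hneg, hneg, hmix]
  field_simp

end PainleveBlock

theorem corollary3 {p : ℕ} (a : Fin p → ℂ) (K : ℕ) (hK : 0 < K) (σ u : ℂ)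
    (hσ : ∀ n : ℤ, 2 * σ ≠ n)
    (ha : ∀ (i : Fin p) (n : ℕ), a i + σ ≠ -((n : ℂ) + 1) ∧ a i - σ ≠ -((n : ℂ) + 1))
    (hu : ∀ k : ℕ, k ≤ 4 * K - 2 →
      PainleveBlock.NuIntegrable a K σ (fun z => z ^ k * Complex.exp (u * z))) :
    (∀ q : ℂ, ‖q‖ = 1 → ContDiffWithinAt ℂ ((4 * K - 2 : ℕ) : WithTop ℕ∞)
      (PainleveBlock.mgf a K σ q) (PainleveBlock.mgfDomain a K σ) u) ∧
    CircleIntegrable (fun q => PainleveBlock.wronskian a K σ q u / q) 0 1 ∧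
    HasSum
      (fun x : PainleveBlock.RestrictedPairs K =>
        PainleveBlock.blockCoeff a σ x.1.1 x.1.2 *
          Complex.exp (u * ((x.1.1.card : ℂ) + (x.1.2.card : ℂ))))
      (PainleveBlock.Q a K σ / Complex.exp u ^ (K * (K - 1)) *
        (1 / (2 * (Real.pi : ℂ) * Complex.I) *
          ∮ q in C(0, 1), PainleveBlock.wronskian a K σ q u / q)) := by
  refine ⟨fun q _ => PainleveBlock.contDiffWithinAt_mgf hu q,
    PainleveBlock.circleIntegrable_wronskian hu, ?_⟩
  have hW : ∀ q : ℂ, ‖q‖ = 1 → HasSum (fun f : Fin (2 * K) → ℕ ⊕ ℕ =>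
      q ^ (∑ i, PainleveBlock.charge (f i)) * PainleveBlock.hankelTerm a K σ u f)
      (PainleveBlock.wronskian a K σ q u) :=
    fun q hq => PainleveBlock.hasSum_wronskian hu (norm_ne_zero_iff.1 (hq ▸ one_ne_zero))
  -- At `q = 1` the expansion of the determinant is the plain sum of the terms.
  have hT : Summable fun f : Fin (2 * K) → ℕ ⊕ ℕ => PainleveBlock.hankelTerm a K σ u f := by
    simpa using (hW 1 norm_one).summable
  have h1 := PainleveBlock.hasSum_circleIntegral_zpow _ _ _ hT hW
  -- The sum may be restricted to tuples coming from pairs of partitions: any other tuple has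
  -- nonzero charge or a repeated point, and the latter gives a Vandermonde determinant with two
  -- equal rows.
  have h2 := (Function.Injective.hasSum_iff (PainleveBlock.config_comp_injective K (2 * K)) ?_).2 h1
  -- For each pair, the finitely many orderings of its configuration are summed first.
  · have h3 := h2.prod_fiberwise fun x => hasSum_fintype _
    refine (h3.mul_left (PainleveBlock.Q a K σ / Complex.exp u ^ (K * (K - 1)))).congr_fun fun x => ?_
    rw [← PainleveBlock.sum_hankelTerm x hσ ha]
    simp only [Function.comp_apply, PainleveBlock.sum_charge_config, if_true]
  · intro f hf
    by_contra hne
    rw [ite_eq_right_iff, Classical.not_imp] at hne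
    refine hf (PainleveBlock.exists_config_comp_eq (fun i j hij => ?_) hne.1)
    by_contra hij'
    refine hne.2 ?_
    rw [PainleveBlock.hankelTerm, Matrix.det_zero_of_row_eq hij', mul_zero, mul_zero]
    funext k
    rw [Matrix.vandermonde_apply, Matrix.vandermonde_apply, hij]
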